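/- Let $F=\mathbb F_q$ be a finite field with $q$ elements, let $n\ge 1$, and let $\theta:F^+\to\mathbb C^\times$ be a nontrivial homomorphism. Let $\mathfrak u_n(F)$ be the algebra of strictly upper triangular $n\times n$ matrices over $F$ and $G=U_n(F)=1+\mathfrak u_n(F)$. *Supercharacters.* For $\lambda\in\mathfrak u_n(F)^*$ put $v_\lambda=\sum_{g\in G}\theta(\lambda(g-1))\,g\in\mathbb CG$, and let $\chi_\lambda$ be the complex conjugate of the character of the left $G$-module $\mathbb CG\,v_\lambda$. The functions $\chi_\lambda$ are the supercharacters of $G$. A character $\chi$ of $G$ is Heisenberg if it is irreducible and $\ker\chi\supset[G,[G,G]]$. *Labeled partitions.* An arc of a set partition of $[n]=\{1,\dots,n\}$ is a pair $(i,j)$ such that $i,j$ lie in the same block and $j$ is the least element of this block greater than $i$. An $F$-labeled partition $\Lambda$ of $[n]$ is a set partition of $[n]$ with a label $\Lambda_{ij}\in F^\times$ for each arc $(i,j)$; it is viewed as the functional $X\mapsto\sum_{(i,j)}\Lambda_{ij}X_{ij}$ (sum over the arcs) on $\mathfrak u_n(F)$. *Paths.* Let $\mathscr L_{\mathrm{Pell}}(n,F)$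 be the set of finite sequences of steps from $S=\{(1,0),(1,1),(0,1)\}$, starting at the origin and ending on the line $x+y=n-1$, in which each step $(1,1)$ or $(0,1)$ is labeled by an element of $F^\times$ and the steps $(1,0)$ are unlabeled. **Theorem.** 1. For each $P\in\mathscr L_{\mathrm{Pell}}(n,F)$ there is a unique $F$-labeled partition $\Lambda_P$ of $[n]$ that has an arc $(i,j)$ labeled by $t\in F^\times$ if and only if $P$ has a step labeled by $t$ which travels from a point $(x,y-1)$ to a point $(x',y)$ with $i=x+y$ and $j=x'+y+1$. Writing $\chi_P:=\chi_{\Lambda_P}$, the map $P\mapsto\chi_P$ is a bijection from $\mathscr L_{\mathrm{Pell}}(n,F)$ onto the set of Heisenberg supercharacters of $U_n(F)$. 2. The number of Heisenberg supercharacters of $U_n(F)$ is $\mathrm{Del}_n(q-1)$, where $\mathrm{Del}_n(x)=\sum_{k=0}^{n-1}D(n-1-k,k)\,x^k$ and the Delannoy number $D(a,b)$ is the number of lattice paths from $(0,0)$ to $(a,b)$ with steps in $S$. 3. $\mathrm{Del}_n(1)$ is the $n$th Pell number $p_n$, where $p_0=0$, $p_1=1$, $p_{m+2}=2p_{m+1}+p_m$.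 In particular, for $q=2$ the number of Heisenberg supercharacters of $U_n(F)$ is $p_n$. -/

import Mathlib

noncomputable section

namespace PellHeisenberg

/-! ### The unitriangular group and its algebra -/

/-- The algebra `𝔲ₙ(F)` of strictly upper triangular `n × n` matrices, as a vector space. -/
def strictUpper (n : ℕ) (F : Type*) [Field F] : Submodule F (Matrix (Fin n) (Fin n) F) where
  carrier := {X | ∀ i j, j ≤ i → X i j = 0}
  zero_mem' := fun _ _ _ => rfl
  add_mem' := fun {X Y} hX hY i j h => by simp [hX i j h, hY i j h]
  smul_mem' := fun c X hX i j h => by simp [hX i j h]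

/-- The group `Uₙ(F)` of upper triangular matrices with ones on the diagonal. -/
def unitriangular (n : ℕ) (F : Type*) [Field F] : Subgroup (GL (Fin n) F) where
  carrier := {g | ∀ i j, j ≤ i → (g : Matrix (Fin n) (Fin n) F) i j = (1 : Matrix _ _ F) i j}
  one_mem' := fun _ _ _ => rfl
  mul_mem' := by
    intro g h hg hh i j hij
    rw [Units.val_mul, Matrix.mul_apply, Finset.sum_eq_single i]
    · rw [hg i i le_rfl, hh i j hij, Matrix.one_apply_eq, one_mul]
    · intro k _ hk
      rcases lt_or_gt_of_ne hk with hk | hk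
      · rw [hg i k hk.le, Matrix.one_apply_ne hk.ne', zero_mul]
      · rw [hh k j (hij.trans hk.le), Matrix.one_apply_ne (hij.trans_lt hk).ne', mul_zero]
    · simp
  inv_mem' := by
    intro g hg
    have hT : Matrix.BlockTriangular (g : Matrix (Fin n) (Fin n) F) id := fun i j hij => by
      have hij' : j < i := hij
      exact (hg i j hij'.le).trans (Matrix.one_apply_ne hij'.ne')
    have hT' : Matrix.BlockTriangular ((g⁻¹ : GL (Fin n) F) : Matrix (Fin n) (Fin n) F) id := by
      have : Invertible (g : Matrix (Fin n) (Fin n) F) := g.invertible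
      rw [Matrix.coe_units_inv]
      exact Matrix.blockTriangular_inv_of_blockTriangular hT
    intro i j hij
    rcases hij.eq_or_lt with rfl | hlt
    · have h1 : ((g : Matrix (Fin n) (Fin n) F) *
          ((g⁻¹ : GL (Fin n) F) : Matrix (Fin n) (Fin n) F)) j j = 1 := by
        rw [← Units.val_mul, mul_inv_cancel]; simp
      rw [Matrix.mul_apply, Finset.sum_eq_single j, hg j j le_rfl, Matrix.one_apply_eq,
        one_mul] at h1
      · rw [h1, Matrix.one_apply_eq]
      · intro k _ hk
        rcases lt_or_gt_of_ne hk with hk | hk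
        · rw [hg j k hk.le, Matrix.one_apply_ne hk.ne', zero_mul]
        · rw [hT' hk, mul_zero]
      · simp
    · rw [hT' hlt, Matrix.one_apply_ne hlt.ne']

/-- The map `g ↦ g - 1` from `Uₙ(F)` to `𝔲ₙ(F)`. -/
def subOne {n : ℕ} {F : Type*} [Field F] (g : unitriangular n F) : strictUpper n F :=
  ⟨((g : GL (Fin n) F) : Matrix (Fin n) (Fin n) F) - 1, fun i j h => by
    rw [Matrix.sub_apply, g.2 i j h, sub_self]⟩

/-! ### Supercharacters -/

/-- The element `v_λ = ∑_g θ(λ(g - 1)) g` of the group algebra of `G = Uₙ(F)`. -/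
def superVector {n : ℕ} {F : Type*} [Field F] [Finite F] (θ : AddChar F ℂ)
    (l : Module.Dual F (strictUpper n F)) : MonoidAlgebra ℂ (unitriangular n F) :=
  letI := Fintype.ofFinite (unitriangular n F)
  ∑ g : unitriangular n F, MonoidAlgebra.single g (θ (l (subOne g)))

/-- The left `ℂG`-module `ℂG v_λ`. -/
abbrev superModule {n : ℕ} {F : Type*} [Field F] [Finite F] (θ : AddChar F ℂ)
    (l : Module.Dual F (strictUpper n F)) :
    Submodule (MonoidAlgebra ℂ (unitriangular n F)) (MonoidAlgebra ℂ (unitriangular n F)) :=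
  Submodule.span _ {superVector θ l}

/-- The supercharacter `χ_λ`: the complex conjugate of the character of `ℂG v_λ`. -/
def superchar {n : ℕ} {F : Type*} [Field F] [Finite F] (θ : AddChar F ℂ)
    (l : Module.Dual F (strictUpper n F)) : unitriangular n F → ℂ := fun g =>
  starRingEnd ℂ ((Representation.ofModule' (k := ℂ) (G := unitriangular n F)
    (superModule θ l)).character g)

/-- The supercharacters of `Uₙ(F)`. -/
def IsSupercharacter {n : ℕ} {F : Type*} [Field F] [Finite F] (θ : AddChar F ℂ)
    (χ : unitriangular n F → ℂ) : Prop :=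
  ∃ l : Module.Dual F (strictUpper n F), χ = superchar θ l

/-! ### Heisenberg characters -/

/-- `χ` is the character of an irreducible finite-dimensional complex representation. -/
def IsIrreducibleCharacter {G : Type*} [Group G] (χ : G → ℂ) : Prop :=
  ∃ (d : ℕ) (ρ : Representation ℂ G (Fin d → ℂ)), ρ.IsIrreducible ∧ ρ.character = χ

/-- A Heisenberg character: irreducible, with kernel `{g | χ g = χ 1}` containing
`[G, [G, G]]`. -/
def IsHeisenberg {G : Type*} [Group G] (χ : G → ℂ) : Prop :=
  IsIrreducibleCharacter χ ∧
    ∀ g ∈ (⁅(⊤ : Subgroup G), ⁅(⊤ : Subgroup G), (⊤ : Subgroup G)⁆⁆ : Subgroup G), χ g = χ 1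

/-- The set of Heisenberg supercharacters of `Uₙ(F)`. -/
def heisenbergSupercharacters (n : ℕ) {F : Type*} [Field F] [Finite F] (θ : AddChar F ℂ) :
    Set (unitriangular n F → ℂ) :=
  {χ | IsSupercharacter θ χ ∧ IsHeisenberg χ}

/-! ### Labeled set partitions -/

/-- `(i, j)` is an arc of a set partition: `i` and `j` lie in the same block and `j` is the least
element of this block that is greater than `i`. -/
def IsArc {n : ℕ} (p : Finpartition (Finset.univ : Finset (Fin n))) (i j : Fin n) : Prop :=
  ∃ B ∈ p.parts, i ∈ B ∧ j ∈ B ∧ i < j ∧ ∀ k ∈ B, i < k → j ≤ k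

/-- An `F`-labeled partition of `[n]` (with `[n]` modeled by `Fin n`): a set partition together
with a nonzero label for each arc. The labels are extended by `0` to all pairs `(i, j)`. -/
@[ext]
structure LabeledPartition (n : ℕ) (F : Type*) [Field F] where
  partition : Finpartition (Finset.univ : Finset (Fin n))
  label : Fin n → Fin n → F
  label_ne_zero_iff : ∀ i j, label i j ≠ 0 ↔ IsArc partition i j

/-- The functional `X ↦ ∑_{(i, j) arc} Λ_{ij} X_{ij}` on `𝔲ₙ(F)` (pairs that are not arcs have
label `0`). -/
def LabeledPartition.functional {n : ℕ} {F : Type*} [Field F] (L : LabeledPartition n F) :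
    Module.Dual F (strictUpper n F) where
  toFun X := ∑ i, ∑ j, L.label i j * (X : Matrix (Fin n) (Fin n) F) i j
  map_add' X Y := by simp [mul_add, Finset.sum_add_distrib]
  map_smul' c X := by simp [Finset.mul_sum, mul_left_comm]

/-! ### Labeled lattice paths -/

/-- A labeled step: a step `(i, j) ∈ S` with a sequence of `j` nonzero labels. -/
structure LabeledStep (F : Type*) [Field F] (S : Set (ℕ × ℕ)) where
  step : ℕ × ℕ
  mem : step ∈ S
  label : Fin step.2 → Fˣ

/-- The endpoint of a labeled lattice path starting at the origin. -/
def endpoint {F : Type*} [Field F] {S : Set (ℕ × ℕ)} (P : List (LabeledStep F S)) : ℕ × ℕ :=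
  (P.map LabeledStep.step).sum

/-- The labeled lattice paths with steps in `S` ending on the line `x + y = n - 1`. -/
def LabeledPath (n : ℕ) (F : Type*) [Field F] (S : Set (ℕ × ℕ)) : Type _ :=
  {P : List (LabeledStep F S) // (endpoint P).1 + (endpoint P).2 + 1 = n}

/-- The steps `(1,0)`, `(1,1)`, `(0,1)`. -/
def pellSteps : Set (ℕ × ℕ) := {(1, 0), (1, 1), (0, 1)}

/-- `P` has a step labeled by `t` that travels from the point `a` to the point `b`. -/
def HasLabeledStep {F : Type*} [Field F] {S : Set (ℕ × ℕ)} (P : List (LabeledStep F S))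
    (a b : ℕ × ℕ) (t : Fˣ) : Prop :=
  ∃ (P₁ P₂ : List (LabeledStep F S)) (s : LabeledStep F S), P = P₁ ++ s :: P₂ ∧
    endpoint P₁ = a ∧ a + s.step = b ∧ ∃ k, s.label k = t

/-- `Λ` is the labeled partition attached to the path `P`: it has an arc `(i, j)` labeled by `t`
if and only if `P` has a step labeled by `t` from `(x, y)` to `(x', y + 1)` with
`i = x + (y + 1)` and `j = x' + (y + 1) + 1`. (The elements of `[n]` are counted from `1`, those of
`Fin n` from `0`.) -/
def IsPathPartition {n : ℕ} {F : Type*} [Field F] (P : LabeledPath n F pellSteps)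
    (L : LabeledPartition n F) : Prop :=
  ∀ (i j : Fin n) (t : Fˣ), (IsArc L.partition i j ∧ L.label i j = t) ↔
    ∃ x x' y : ℕ, HasLabeledStep P.1 (x, y) (x', y + 1) t ∧
      (i : ℕ) + 1 = x + (y + 1) ∧ (j : ℕ) + 1 = x' + (y + 1) + 1

/-! ### Delannoy numbers and Pell numbers -/

/-- The Delannoy number `D(a, b)`: the number of lattice paths from the origin to `(a, b)` with
steps `(1,0)`, `(1,1)`, `(0,1)`. -/
def delannoy (a b : ℕ) : ℕ :=
  Set.ncard {P : List (ℕ × ℕ) | (∀ s ∈ P, s ∈ pellSteps) ∧ P.sum = (a, b)}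

/-- The polynomial `∑_{k=0}^{n-1} D(n-1-k, k) x^k`. -/
def delannoyPoly (n : ℕ) : Polynomial ℤ :=
  ∑ k ∈ Finset.range n, Polynomial.C (delannoy (n - 1 - k) k : ℤ) * Polynomial.X ^ k

/-- The Pell numbers `0, 1, 2, 5, 12, 29, 70, …`. -/
def pell : ℕ → ℕ
  | 0 => 0
  | 1 => 1
  | m + 2 => 2 * pell (m + 1) + pell m

end PellHeisenberg

end

open PellHeisenberg

noncomputable section

namespace PellHeisenberg

section

variable {n : ℕ} {F : Type*} [Field F]

/-! ### Multiplication of strictly upper triangular matrices by unitriangular ones -/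

/-! The module `ℂG v_λ` is monomial. Left multiplication by `g` sends `v_μ` to a scalar multiple of
`v_{gμ}`, and distinct `v_μ` are linearly independent because distinct additive characters are. So
the `v_μ` with `μ` in the left orbit of `λ` form a basis, and the character at `g` is the sum of
`θ(μ(g⁻¹ - 1))` over the `μ` in the orbit fixed by `g` (`superRep_character`). Conjugation replaces
`λ` by `-λ`, and the character depends only on the two-sided orbit of `λ`.

Testing on `1 + tE_{ij}` with `j > i + 2` shows that the kernel contains `[G,[G,G]]` exactly when
`λ` involves only coefficients `a_i` at `(i,i+1)` and `c_i` at `(i,i+2)`. On such a `λ` the left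
action changes `a_{i+1}` by multiples of `c_i`, and the right action changes `a_i` by multiples of
`c_i`. Irreducibility means that the endomorphism algebra has dimension one, and this holds exactly
when no two consecutive `c_i` are nonzero. If `c_i` and `c_{i+1}` are both nonzero, a right
translate of `λ` that differs from it lies in its left orbit, and right multiplication is a
nonscalar endomorphism (`ract_eq_of_finrank`). Otherwise transvections fixing both `λ` and another
point of the orbit act on the two basis vectors by different scalars
(`finrank_eq_one_of_separated`).

When no two consecutive `c_i` are nonzero, the two actions clear `a_i` and `a_{i+1}` wherever `c_i ≠
0`. The remaining coefficients can be read off the character at transvections, so this normal form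
is unique. It is also a tiling of an interval of length `n - 1`: a nonzero `c_i` is a diagonal step,
covering two units, and each remaining unit is a step `(0,1)` or `(1,0)` according to whether its
`a_i` is nonzero. This gives the bijection with labeled paths. Splitting off the first step gives
the same recurrence for the number of labeled paths and for the values of `delannoyPoly`; at `x = 1`
it is the Pell recurrence. -/

lemma unitriangular_apply_of_lt (g : unitriangular n F) {i j : Fin n} (h : j < i) :
    (g : GL (Fin n) F).1 i j = 0 := by
  rw [g.2 i j h.le, Matrix.one_apply_ne h.ne']

/-- Left multiplication by `g` on `𝔲ₙ(F)`. -/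
def lmul (g : unitriangular n F) : strictUpper n F →ₗ[F] strictUpper n F where
  toFun X := ⟨(g : GL (Fin n) F).1 * X.1, fun i j hij => by
    rw [Matrix.mul_apply]
    refine Finset.sum_eq_zero fun k _ => ?_
    rcases lt_or_ge k i with hk | hk
    · rw [unitriangular_apply_of_lt g hk, zero_mul]
    · rw [X.2 k j (hij.trans hk), mul_zero]⟩
  map_add' X Y := Subtype.ext (mul_add _ _ _)
  map_smul' c X := Subtype.ext (Matrix.mul_smul _ _ _)

/-- Right multiplication by `g` on `𝔲ₙ(F)`. -/
def rmul (g : unitriangular n F) : strictUpper n F →ₗ[F] strictUpper n F where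
  toFun X := ⟨X.1 * (g : GL (Fin n) F).1, fun i j hij => by
    rw [Matrix.mul_apply]
    refine Finset.sum_eq_zero fun k _ => ?_
    rcases lt_or_ge j k with hk | hk
    · rw [unitriangular_apply_of_lt g hk, mul_zero]
    · rw [X.2 i k (hk.trans hij), zero_mul]⟩
  map_add' X Y := Subtype.ext (add_mul _ _ _)
  map_smul' c X := Subtype.ext (Matrix.smul_mul _ _ _)

lemma coe_lmul (g : unitriangular n F) (X : strictUpper n F) :
    (lmul g X).1 = (g : GL (Fin n) F).1 * X.1 := rfl

lemma coe_rmul (g : unitriangular n F) (X : strictUpper n F) :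
    (rmul g X).1 = X.1 * (g : GL (Fin n) F).1 := rfl

lemma coe_subOne (g : unitriangular n F) : (subOne g).1 = (g : GL (Fin n) F).1 - 1 := rfl

lemma lmul_one (X : strictUpper n F) : lmul 1 X = X := Subtype.ext (one_mul _)

lemma rmul_one (X : strictUpper n F) : rmul 1 X = X := Subtype.ext (mul_one _)

lemma lmul_mul (g h : unitriangular n F) (X : strictUpper n F) :
    lmul (g * h) X = lmul g (lmul h X) := Subtype.ext (mul_assoc _ _ _)

lemma rmul_mul (g h : unitriangular n F) (X : strictUpper n F) :
    rmul (g * h) X = rmul h (rmul g X) := Subtype.ext (mul_assoc _ _ _).symm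

lemma lmul_rmul (g h : unitriangular n F) (X : strictUpper n F) :
    lmul g (rmul h X) = rmul h (lmul g X) := Subtype.ext (mul_assoc _ _ _).symm

lemma subOne_one : subOne (1 : unitriangular n F) = 0 := Subtype.ext (sub_self _)

lemma subOne_mul (g h : unitriangular n F) :
    subOne (g * h) = lmul g (subOne h) + subOne g := by
  apply Subtype.ext
  rw [Submodule.coe_add, coe_lmul, coe_subOne, coe_subOne, coe_subOne]
  simp [mul_sub]

lemma subOne_mul' (g h : unitriangular n F) :
    subOne (g * h) = rmul h (subOne g) + subOne h := by
  apply Subtype.ext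
  rw [Submodule.coe_add, coe_rmul, coe_subOne, coe_subOne, coe_subOne]
  simp [sub_mul]

/-- The element `1 + X` of `Uₙ(F)`. -/
def oneAdd (X : strictUpper n F) : unitriangular n F :=
  ⟨Matrix.GeneralLinearGroup.mkOfDetNeZero (1 + X.1) (by
    have : Matrix.BlockTriangular (1 + X.1) id := fun i j (hij : j < i) => by
      rw [Matrix.add_apply, X.2 i j hij.le, Matrix.one_apply_ne hij.ne', add_zero]
    rw [Matrix.det_of_isUpperTriangular this, Finset.prod_eq_one]
    · exact one_ne_zero
    · intro i _
      rw [Matrix.add_apply, X.2 i i le_rfl, Matrix.one_apply_eq, add_zero]), fun i j hij => by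
    change (1 + X.1) i j = _
    rw [Matrix.add_apply, X.2 i j hij, add_zero]⟩

lemma subOne_oneAdd (X : strictUpper n F) : subOne (oneAdd X) = X :=
  Subtype.ext (add_sub_cancel_left _ _)

lemma lmul_eq_add (g : unitriangular n F) (X : strictUpper n F) :
    (lmul g X).1 = X.1 + (subOne g).1 * X.1 := by
  rw [coe_lmul, coe_subOne, sub_mul, one_mul, add_sub_cancel]

lemma rmul_eq_add (g : unitriangular n F) (X : strictUpper n F) :
    (rmul g X).1 = X.1 + X.1 * (subOne g).1 := by
  rw [coe_rmul, coe_subOne, mul_sub, mul_one, add_sub_cancel]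

/-- No index lies strictly between `i` and `i + 1`, and only one lies between `i` and `i + 2`. Hence
multiplication by a unitriangular matrix fixes the first superdiagonal and corrects each entry of
the second by a single product. -/
lemma strictUpper_mul_apply_one (X Y : strictUpper n F) {i j : Fin n}
    (hj : (j : ℕ) = i + 1) : (X.1 * Y.1) i j = 0 := by
  rw [Matrix.mul_apply]
  refine Finset.sum_eq_zero fun k _ => ?_
  rcases le_or_gt k i with hk | hk
  · rw [X.2 i k hk, zero_mul]
  · rw [Y.2 k j (by rw [Fin.le_def]; rw [Fin.lt_def] at hk; omega), mul_zero]

lemma strictUpper_mul_apply_two (X Y : strictUpper n F) {i j k : Fin n}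
    (hj : (j : ℕ) = i + 1) (hk : (k : ℕ) = i + 2) : (X.1 * Y.1) i k = X.1 i j * Y.1 j k := by
  rw [Matrix.mul_apply, Finset.sum_eq_single j]
  · intro l _ hl
    rcases le_or_gt l i with h | h
    · rw [X.2 i l h, zero_mul]
    · rw [Y.2 l k (by
        rw [Fin.le_def]; rw [Fin.lt_def] at h
        have : (l : ℕ) ≠ j := fun h => hl (Fin.ext h)
        omega), mul_zero]
  · simp

lemma lmul_apply_one (g : unitriangular n F) (X : strictUpper n F) {i j : Fin n}
    (hj : (j : ℕ) = i + 1) : (lmul g X).1 i j = X.1 i j := by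
  rw [lmul_eq_add, Matrix.add_apply, strictUpper_mul_apply_one _ _ hj, add_zero]

lemma rmul_apply_one (g : unitriangular n F) (X : strictUpper n F) {i j : Fin n}
    (hj : (j : ℕ) = i + 1) : (rmul g X).1 i j = X.1 i j := by
  rw [rmul_eq_add, Matrix.add_apply, strictUpper_mul_apply_one _ _ hj, add_zero]

lemma lmul_apply_two (g : unitriangular n F) (X : strictUpper n F) {i j k : Fin n}
    (hj : (j : ℕ) = i + 1) (hk : (k : ℕ) = i + 2) :
    (lmul g X).1 i k = X.1 i k + (subOne g).1 i j * X.1 j k := by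
  rw [lmul_eq_add, Matrix.add_apply, strictUpper_mul_apply_two _ _ hj hk]

lemma rmul_apply_two (g : unitriangular n F) (X : strictUpper n F) {i j k : Fin n}
    (hj : (j : ℕ) = i + 1) (hk : (k : ℕ) = i + 2) :
    (rmul g X).1 i k = X.1 i k + X.1 i j * (subOne g).1 j k := by
  rw [rmul_eq_add, Matrix.add_apply, strictUpper_mul_apply_two _ _ hj hk]

/-! ### Functionals on strictly upper triangular matrices -/

/-- The elementary matrix `E_{ij}`, read as `0` unless `i < j`. -/
def elementary (F : Type*) [Field F] (i j : Fin n) : strictUpper n F :=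
  if h : i < j then ⟨Matrix.single i j 1, fun k l hkl => by
    rw [Matrix.single_apply, if_neg]
    rintro ⟨rfl, rfl⟩
    exact absurd h hkl.not_gt⟩ else 0

lemma coe_elementary {i j : Fin n} (h : i < j) :
    (elementary F i j).1 = Matrix.single i j 1 := by rw [elementary, dif_pos h]

lemma elementary_apply_self {i j : Fin n} (h : i < j) : (elementary F i j).1 i j = 1 := by
  rw [coe_elementary h, Matrix.single_apply_same]

lemma elementary_apply_of_ne {i j k l : Fin n} (h : ¬ (i = k ∧ j = l)) :
    (elementary F i j).1 k l = 0 := by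
  by_cases hij : i < j
  · rw [coe_elementary hij, Matrix.single_apply, if_neg h]
  · rw [elementary, dif_neg hij]; rfl

/-- The coefficient `λ(E_{ij})`. -/
def coef (l : Module.Dual F (strictUpper n F)) (i j : Fin n) : F := l (elementary F i j)

lemma coef_eq_zero_of_le (l : Module.Dual F (strictUpper n F)) {i j : Fin n} (h : j ≤ i) :
    coef l i j = 0 := by
  rw [coef, elementary, dif_neg h.not_gt, map_zero]

lemma eq_sum_elementary (X : strictUpper n F) :
    X = ∑ i, ∑ j, X.1 i j • elementary F i j := by
  apply Subtype.ext
  ext k l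
  simp only [AddSubmonoidClass.coe_finsetSum, Matrix.sum_apply, Submodule.coe_smul,
    Matrix.smul_apply]
  rw [Finset.sum_eq_single k, Finset.sum_eq_single l]
  · rcases lt_or_ge k l with h | h
    · rw [elementary_apply_self h, smul_eq_mul, mul_one]
    · rw [X.2 k l h, zero_smul]
  · intro j _ hj
    rw [elementary_apply_of_ne (fun h => hj h.2), smul_zero]
  · simp
  · intro i _ hi
    refine Finset.sum_eq_zero fun j _ => ?_
    rw [elementary_apply_of_ne (fun h => hi h.1), smul_zero]
  · simp

lemma dual_apply (l : Module.Dual F (strictUpper n F)) (X : strictUpper n F) :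
    l X = ∑ i, ∑ j, coef l i j * X.1 i j := by
  conv_lhs => rw [eq_sum_elementary X]
  simp [coef, mul_comm]

lemma dual_ext {l m : Module.Dual F (strictUpper n F)}
    (h : ∀ i j, i < j → coef l i j = coef m i j) : l = m := by
  ext X
  rw [dual_apply, dual_apply]
  refine Finset.sum_congr rfl fun i _ => Finset.sum_congr rfl fun j _ => ?_
  rcases lt_or_ge i j with hij | hij
  · rw [h i j hij]
  · rw [X.2 i j hij, mul_zero, mul_zero]

/-- `λ` vanishes on the cube of `𝔲ₙ(F)`. -/
def IsShort (l : Module.Dual F (strictUpper n F)) : Prop :=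
  ∀ i j : Fin n, (i : ℕ) + 2 < j → coef l i j = 0

/-- The comparison is weighted by the coefficients, so the matrices need to agree only where the
functional does not vanish. -/
lemma IsShort.apply_eq {l : Module.Dual F (strictUpper n F)} (hl : IsShort l)
    {X Y : strictUpper n F}
    (h₁ : ∀ i j : Fin n, (j : ℕ) = i + 1 → coef l i j * X.1 i j = coef l i j * Y.1 i j)
    (h₂ : ∀ i j : Fin n, (j : ℕ) = i + 2 → coef l i j * X.1 i j = coef l i j * Y.1 i j) :
    l X = l Y := by
  rw [dual_apply, dual_apply]
  refine Finset.sum_congr rfl fun i _ => Finset.sum_congr rfl fun j _ => ?_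
  rcases lt_or_ge i j with hij | hij
  · rw [Fin.lt_def] at hij
    obtain h | h | h : (j : ℕ) = i + 1 ∨ (j : ℕ) = i + 2 ∨ (i : ℕ) + 2 < j := by omega
    · exact h₁ i j h
    · exact h₂ i j h
    · rw [hl i j h, zero_mul, zero_mul]
  · rw [X.2 i j hij, Y.2 i j hij]

/-- The left action of `Uₙ(F)` on functionals, `(gλ)(X) = λ(g⁻¹X)`. -/
def lact (g : unitriangular n F) (l : Module.Dual F (strictUpper n F)) :
    Module.Dual F (strictUpper n F) := l ∘ₗ lmul g⁻¹

/-- The right action of `Uₙ(F)` on functionals, `λ ↦ (X ↦ λ(X h))`. -/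
def ract (h : unitriangular n F) (l : Module.Dual F (strictUpper n F)) :
    Module.Dual F (strictUpper n F) := l ∘ₗ rmul h

lemma lact_apply (g : unitriangular n F) (l : Module.Dual F (strictUpper n F))
    (X : strictUpper n F) : lact g l X = l (lmul g⁻¹ X) := rfl

lemma ract_apply (g : unitriangular n F) (l : Module.Dual F (strictUpper n F))
    (X : strictUpper n F) : ract g l X = l (rmul g X) := rfl

lemma lact_one (l : Module.Dual F (strictUpper n F)) : lact 1 l = l := by
  ext X; rw [lact_apply, inv_one, lmul_one]

lemma lact_mul (g h : unitriangular n F) (l : Module.Dual F (strictUpper n F)) :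
    lact (g * h) l = lact g (lact h l) := by
  ext X; rw [lact_apply, lact_apply, lact_apply, mul_inv_rev, lmul_mul]

lemma ract_mul (g h : unitriangular n F) (l : Module.Dual F (strictUpper n F)) :
    ract (g * h) l = ract g (ract h l) := by
  ext X; rw [ract_apply, ract_apply, ract_apply, rmul_mul]

lemma ract_one (l : Module.Dual F (strictUpper n F)) : ract 1 l = l := by
  ext X; rw [ract_apply, rmul_one]

lemma lact_ract (g h : unitriangular n F) (l : Module.Dual F (strictUpper n F)) :
    lact g (ract h l) = ract h (lact g l) := by
  ext X; rw [lact_apply, ract_apply, ract_apply, lact_apply, lmul_rmul]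

lemma lact_neg (g : unitriangular n F) (l : Module.Dual F (strictUpper n F)) :
    lact g (-l) = -lact g l := rfl

/-- Right translation as a permutation of the functionals. -/
def ractEquiv (h : unitriangular n F) :
    Module.Dual F (strictUpper n F) ≃ Module.Dual F (strictUpper n F) where
  toFun := ract h
  invFun := ract h⁻¹
  left_inv l := by rw [← ract_mul, inv_mul_cancel, ract_one]
  right_inv l := by rw [← ract_mul, mul_inv_cancel, ract_one]

/-- The left orbit of a functional. -/
def leftOrbit (l : Module.Dual F (strictUpper n F)) : Set (Module.Dual F (strictUpper n F)) :=
  Set.range fun g => lact g l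

lemma lact_mem_leftOrbit {l m : Module.Dual F (strictUpper n F)} (h : m ∈ leftOrbit l)
    (g : unitriangular n F) : lact g m ∈ leftOrbit l := by
  obtain ⟨x, rfl⟩ := h
  exact ⟨g * x, lact_mul g x l⟩

lemma self_mem_leftOrbit (l : Module.Dual F (strictUpper n F)) : l ∈ leftOrbit l :=
  ⟨1, lact_one l⟩

lemma leftOrbit_eq_of_mem {l m : Module.Dual F (strictUpper n F)} (h : m ∈ leftOrbit l) :
    leftOrbit m = leftOrbit l := by
  obtain ⟨x, rfl⟩ := h
  refine Set.Subset.antisymm ?_ ?_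
  · rintro _ ⟨y, rfl⟩
    exact ⟨y * x, lact_mul _ _ _⟩
  · rintro _ ⟨y, rfl⟩
    exact ⟨y * x⁻¹, by dsimp only; rw [← lact_mul, inv_mul_cancel_right]⟩

end

section

variable {n : ℕ} {F : Type*} [Field F]

/-! ### The modules `ℂG v_λ` -/

/-- The additive character `X ↦ θ(λ(X))` of `𝔲ₙ(F)`. -/
def dualChar (θ : AddChar F ℂ) (l : Module.Dual F (strictUpper n F)) :
    AddChar (strictUpper n F) ℂ := θ.compAddMonoidHom l.toAddMonoidHom

lemma dualChar_apply (θ : AddChar F ℂ) (l : Module.Dual F (strictUpper n F))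
    (X : strictUpper n F) : dualChar θ l X = θ (l X) := rfl

/-- The multiples of `a - b ≠ 0` fill the field, so `θ` would be trivial otherwise. This turns every
inequality of coefficients below into an inequality of character values. -/
lemma exists_smul_addChar_ne {θ : AddChar F ℂ} (hθ : θ ≠ 1) {a b : F} (h : a ≠ b) :
    ∃ t, θ (t * a) ≠ θ (t * b) := by
  by_contra! H
  apply hθ
  ext u
  have h0 : a - b ≠ 0 := sub_ne_zero.2 h
  have h1 := H (u / (a - b))
  have h2 : u = u / (a - b) * a - u / (a - b) * b := by field_simp
  rw [AddChar.one_apply, h2, AddChar.map_sub_eq_div, h1, div_self]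
  exact (θ.val_isUnit _).ne_zero

lemma dualChar_injective {θ : AddChar F ℂ} (hθ : θ ≠ 1) :
    Function.Injective (dualChar (n := n) θ) := by
  intro l m h
  ext X
  by_contra hX
  obtain ⟨t, ht⟩ := exists_smul_addChar_ne hθ hX
  apply ht
  have := DFunLike.congr_fun h (t • X)
  simpa only [dualChar_apply, map_smul, smul_eq_mul] using this

variable [Finite F]

lemma superVector_coeff (θ : AddChar F ℂ) (l : Module.Dual F (strictUpper n F))
    (g : unitriangular n F) : (superVector θ l).coeff g = θ (l (subOne g)) := by
  classical
  let _ := Fintype.ofFinite (unitriangular n F)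
  rw [superVector, MonoidAlgebra.coeff_sum, Finsupp.finsetSum_apply, Finset.sum_eq_single g]
  · simp
  · intro h _ hh
    simp [hh]
  · simp

/-- The coefficient at `x` is governed by `g⁻¹x - 1 = g⁻¹(x - 1) + (g⁻¹ - 1)`: the first summand
gives the translated functional, the second the scalar. -/
lemma single_mul_superVector (θ : AddChar F ℂ) (l : Module.Dual F (strictUpper n F))
    (g : unitriangular n F) : MonoidAlgebra.single g (1 : ℂ) * superVector θ l =
      θ (l (subOne g⁻¹)) • superVector θ (lact g l) := by
  ext x
  rw [MonoidAlgebra.coeff_single_mul_apply, MonoidAlgebra.coeff_smul, Finsupp.smul_apply,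
    superVector_coeff, superVector_coeff, one_mul, subOne_mul, map_add, AddChar.map_add_eq_mul,
    lact_apply, smul_eq_mul, mul_comm]

lemma superVector_mul_single (θ : AddChar F ℂ) (l : Module.Dual F (strictUpper n F))
    (g : unitriangular n F) : superVector θ l * MonoidAlgebra.single g (1 : ℂ) =
      θ (l (subOne g⁻¹)) • superVector θ (ract g⁻¹ l) := by
  ext x
  rw [MonoidAlgebra.coeff_mul_single_apply, MonoidAlgebra.coeff_smul, Finsupp.smul_apply,
    superVector_coeff, superVector_coeff, mul_one, subOne_mul', map_add, AddChar.map_add_eq_mul,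
    ract_apply, smul_eq_mul, mul_comm]

/-- Read along `X ↦ 1 + X`, the coefficients of `v_λ` form the additive character `θ ∘ λ`, and
distinct characters are linearly independent. -/
lemma linearIndependent_superVector {θ : AddChar F ℂ} (hθ : θ ≠ 1) :
    LinearIndependent ℂ (superVector (n := n) θ) := by
  let φ : MonoidAlgebra ℂ (unitriangular n F) →ₗ[ℂ] (strictUpper n F → ℂ) :=
    { toFun := fun v X => v.coeff (oneAdd X)
      map_add' := fun _ _ => rfl
      map_smul' := fun _ _ => rfl }
  refine LinearIndependent.of_comp φ ?_
  have h := (AddChar.linearIndependent (strictUpper n F) ℂ).comp _ (dualChar_injective hθ)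
  have hφ : φ ∘ superVector θ = (⇑) ∘ dualChar (n := n) θ := by
    ext l X
    change (superVector θ l).coeff (oneAdd X) = θ (l X)
    rw [superVector_coeff, subOne_oneAdd]
  rw [hφ]
  exact h

/-- The representation of `Uₙ(F)` on `ℂG v_λ`. -/
abbrev superRep (θ : AddChar F ℂ) (l : Module.Dual F (strictUpper n F)) :
    Representation ℂ (unitriangular n F) (superModule θ l) :=
  Representation.ofModule' (k := ℂ) (G := unitriangular n F) (superModule θ l)

lemma superVector_mem {θ : AddChar F ℂ} {l m : Module.Dual F (strictUpper n F)}
    (h : m ∈ leftOrbit l) : superVector θ m ∈ superModule θ l := by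
  obtain ⟨g, rfl⟩ := h
  have h1 := single_mul_superVector θ l g
  have h2 : θ (l (subOne g⁻¹)) ≠ 0 := (θ.val_isUnit _).ne_zero
  have h3 : superVector θ (lact g l) =
      MonoidAlgebra.single g (θ (l (subOne g⁻¹)))⁻¹ * superVector θ l := by
    rw [← mul_one (θ (l (subOne g⁻¹)))⁻¹, ← smul_eq_mul (_)⁻¹ (1 : ℂ),
      ← MonoidAlgebra.smul_single, smul_mul_assoc, h1, inv_smul_smul₀ h2]
  rw [h3]
  exact Submodule.smul_mem _ _ (Submodule.mem_span_singleton_self _)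

/-- The vector `v_μ` of `ℂG v_λ`, for `μ` in the left orbit of `λ`. -/
def orbitVector (θ : AddChar F ℂ) (l : Module.Dual F (strictUpper n F)) (m : leftOrbit l) :
    superModule θ l := ⟨superVector θ m.1, superVector_mem m.2⟩

lemma superRep_orbitVector (θ : AddChar F ℂ) (l : Module.Dual F (strictUpper n F))
    (g : unitriangular n F) (m : leftOrbit l) : superRep θ l g (orbitVector θ l m) =
      θ (m.1 (subOne g⁻¹)) • orbitVector θ l ⟨lact g m.1, lact_mem_leftOrbit m.2 g⟩ :=
  Subtype.ext (single_mul_superVector θ m.1 g)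

lemma span_orbitVector (θ : AddChar F ℂ) (l : Module.Dual F (strictUpper n F)) :
    Submodule.span ℂ (Set.range (orbitVector θ l)) = ⊤ := by
  rw [eq_top_iff]
  rintro ⟨x, hx⟩ -
  obtain ⟨a, rfl⟩ := Submodule.mem_span_singleton.1 hx
  induction a using MonoidAlgebra.induction_linear with
  | zero =>
    convert Submodule.zero_mem _
    exact zero_smul _ _
  | add a b ha hb =>
    convert Submodule.add_mem _ (ha (Submodule.smul_mem _ _ (Submodule.mem_span_singleton_self _)))
      (hb (Submodule.smul_mem _ _ (Submodule.mem_span_singleton_self _)))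
    exact add_smul _ _ _
  | single g c =>
    have : (⟨MonoidAlgebra.single g c • superVector θ l, hx⟩ : superModule θ l) =
        c • superRep θ l g (orbitVector θ l ⟨l, self_mem_leftOrbit l⟩) := by
      apply Subtype.ext
      change MonoidAlgebra.single g c * superVector θ l =
        c • (MonoidAlgebra.single g (1 : ℂ) * superVector θ l)
      rw [← smul_mul_assoc, MonoidAlgebra.smul_single, smul_eq_mul, mul_one]
    rw [this, superRep_orbitVector]
    exact Submodule.smul_mem _ _ (Submodule.smul_mem _ _ (Submodule.subset_span ⟨_, rfl⟩))

/-- The basis of `ℂG v_λ` formed by the vectors `v_μ`. -/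
def orbitBasis {θ : AddChar F ℂ} (hθ : θ ≠ 1) (l : Module.Dual F (strictUpper n F)) :
    Module.Basis (leftOrbit l) ℂ (superModule θ l) :=
  Module.Basis.mk (v := orbitVector θ l)
    (LinearIndependent.of_comp ((superModule θ l).subtype.restrictScalars ℂ)
      ((linearIndependent_superVector hθ).comp _ Subtype.val_injective))
    (span_orbitVector θ l).ge

lemma orbitBasis_apply {θ : AddChar F ℂ} (hθ : θ ≠ 1) (l : Module.Dual F (strictUpper n F))
    (m : leftOrbit l) : orbitBasis hθ l m = orbitVector θ l m := Module.Basis.mk_apply _ _ _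

-- In the basis of orbit vectors `g` acts by a monomial matrix, and only the fixed points contribute
-- to its trace. Summing over the whole dual space, with zeros off the orbit, makes later reindexing
-- easy.
open Classical in
lemma superRep_character {θ : AddChar F ℂ} (hθ : θ ≠ 1) (l : Module.Dual F (strictUpper n F))
    [Fintype (Module.Dual F (strictUpper n F))] (g : unitriangular n F) :
    (superRep θ l).character g = ∑ m : Module.Dual F (strictUpper n F),
      if m ∈ leftOrbit l ∧ lact g m = m then θ (m (subOne g⁻¹)) else 0 := by
  have hF : Fintype {m // m ∈ leftOrbit l} := Fintype.ofFinite _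
  rw [Representation.character, LinearMap.trace_eq_matrix_trace ℂ (orbitBasis hθ l), Matrix.trace]
  simp only [Matrix.diag_apply, LinearMap.toMatrix_apply, orbitBasis_apply, superRep_orbitVector,
    map_smul, Finsupp.smul_apply]
  simp only [← orbitBasis_apply hθ, Module.Basis.repr_self, Finsupp.single_apply, Subtype.ext_iff,
    ite_and]
  rw [← Finset.sum_filter]
  have h := Finset.sum_subtype (p := (· ∈ leftOrbit l)) (F := hF)
    (Finset.univ.filter (· ∈ leftOrbit l)) (by simp)
    fun m => if lact g m = m then θ (m (subOne g⁻¹)) else 0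
  rw [h]
  refine Finset.sum_congr rfl fun m _ => ?_
  simp

instance : Finite (Module.Dual F (strictUpper n F)) := DFunLike.finite _

omit [Finite F] in
lemma mem_leftOrbit_neg {l m : Module.Dual F (strictUpper n F)} :
    -m ∈ leftOrbit (-l) ↔ m ∈ leftOrbit l := by
  constructor
  · rintro ⟨g, hg⟩
    exact ⟨g, neg_injective hg⟩
  · rintro ⟨g, rfl⟩
    exact ⟨g, rfl⟩

/-- Since `θ(a)` and `θ(-a)` are conjugate, reindexing the character formula by `μ ↦ -μ` absorbs the
conjugation. -/
lemma superchar_eq_character {θ : AddChar F ℂ} (hθ : θ ≠ 1)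
    (l : Module.Dual F (strictUpper n F)) : superchar θ l = (superRep θ (-l)).character := by
  classical
  let _ := Fintype.ofFinite (Module.Dual F (strictUpper n F))
  ext g
  rw [superRep_character hθ]
  change starRingEnd ℂ ((superRep θ l).character g) = _
  rw [superRep_character hθ, map_sum]
  refine Fintype.sum_equiv (Equiv.neg _) _ _ fun m => ?_
  rw [Equiv.neg_apply, mem_leftOrbit_neg, lact_neg, neg_inj, LinearMap.neg_apply,
    AddChar.map_neg_eq_conj]
  split_ifs
  · rfl
  · exact map_zero _

lemma superRep_character_lact {θ : AddChar F ℂ} (hθ : θ ≠ 1)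
    (l : Module.Dual F (strictUpper n F)) (x : unitriangular n F) :
    (superRep θ (lact x l)).character = (superRep θ l).character := by
  let _ := Fintype.ofFinite (Module.Dual F (strictUpper n F))
  ext g
  rw [superRep_character hθ, superRep_character hθ,
    leftOrbit_eq_of_mem (lact_mem_leftOrbit (self_mem_leftOrbit l) x)]

/-- Right translation commutes with the left action, so it carries orbit to orbit and fixed points
to fixed points. What remains is that the scalar at a fixed point does not change. -/
lemma superRep_character_ract {θ : AddChar F ℂ} (hθ : θ ≠ 1)
    (l : Module.Dual F (strictUpper n F)) (x : unitriangular n F) :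
    (superRep θ (ract x l)).character = (superRep θ l).character := by
  classical
  let _ := Fintype.ofFinite (Module.Dual F (strictUpper n F))
  ext g
  rw [superRep_character hθ, superRep_character hθ]
  refine (Fintype.sum_equiv (ractEquiv x) _ _ fun m => ?_).symm
  change _ = if ract x m ∈ leftOrbit (ract x l) ∧ lact g (ract x m) = ract x m then
    θ (ract x m (subOne g⁻¹)) else 0
  have h1 : ract x m ∈ leftOrbit (ract x l) ↔ m ∈ leftOrbit l := by
    constructor
    · rintro ⟨y, hy⟩
      dsimp only at hy
      rw [lact_ract] at hy
      exact ⟨y, (ractEquiv x).injective hy⟩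
    · rintro ⟨y, rfl⟩
      exact ⟨y, lact_ract _ _ _⟩
  have h2 : lact g (ract x m) = ract x m ↔ lact g m = m := by
    rw [lact_ract]
    exact (ractEquiv x).injective.eq_iff
  rw [h1, h2]
  refine if_ctx_congr Iff.rfl (fun h => ?_) fun _ => rfl
  -- The element `g⁻¹x - 1` is expanded in two ways, as `g⁻¹(x - 1) + (g⁻¹ - 1)` and as `(g⁻¹ - 1)x
  -- + (x - 1)`. Since `gm = m`, the terms with `x - 1` take the same value under `m` and cancel.
  have h3 : subOne (g⁻¹ * x) = subOne (g⁻¹ * x) := rfl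
  conv_lhs at h3 => rw [subOne_mul]
  rw [subOne_mul'] at h3
  have h4 := congrArg m h3
  rw [map_add, map_add, ← lact_apply, h.2, add_comm] at h4
  rw [add_right_cancel h4, ract_apply]

/-! ### Irreducibility through endomorphisms -/

/-- The dimension is the norm `⟨χ, χ⟩`, which depends only on the character. Irreducibility can
therefore be moved between `superModule` and a model on `Fin d → ℂ`. -/
lemma finrank_intertwiningMap_eq {G V W : Type*} [Group G] [Finite G] [AddCommGroup V]
    [Module ℂ V] [FiniteDimensional ℂ V] [AddCommGroup W] [Module ℂ W] [FiniteDimensional ℂ W]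
    {ρ : Representation ℂ G V} {σ : Representation ℂ G W} (h : ρ.character = σ.character) :
    Module.finrank ℂ (Representation.IntertwiningMap ρ ρ) =
      Module.finrank ℂ (Representation.IntertwiningMap σ σ) := by
  let _ := Fintype.ofFinite G
  let _ : Invertible (Nat.card G : ℂ) := invertibleOfNonzero (Nat.cast_ne_zero.2 Nat.card_pos.ne')
  have h1 := Representation.card_inv_mul_sum_char_mul_char_eq_finrank ρ ρ
  have h2 := Representation.card_inv_mul_sum_char_mul_char_eq_finrank σ σ
  rw [h] at h1
  exact_mod_cast h1.symm.trans h2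

lemma isIrreducible_of_finrank_intertwiningMap {G V : Type*} [Group G] [Finite G]
    [AddCommGroup V] [Module ℂ V] [FiniteDimensional ℂ V] (ρ : Representation ℂ G V)
    (h : Module.finrank ℂ (Representation.IntertwiningMap ρ ρ) = 1) : ρ.IsIrreducible := by
  have hV : Nontrivial V := by
    by_contra hV
    rw [not_nontrivial_iff_subsingleton] at hV
    have : Subsingleton (Representation.IntertwiningMap ρ ρ) :=
      ⟨fun f g => Representation.IntertwiningMap.ext (LinearMap.ext fun _ => Subsingleton.elim _ _)⟩
    rw [Module.finrank_zero_of_subsingleton] at h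
    exact zero_ne_one h
  have hid : Representation.IntertwiningMap.id ρ ≠ 0 := by
    intro h0
    obtain ⟨v, hv⟩ := exists_ne (0 : V)
    exact hv (DFunLike.congr_fun h0 v)
  have : NeZero (Nat.card G : ℂ) := ⟨Nat.cast_ne_zero.2 Nat.card_pos.ne'⟩
  rw [Representation.irreducible_iff_isSimpleModule_asModule, isSimpleModule_iff]
  have hV' : Nontrivial ρ.asModule := hV
  refine { toNontrivial := inferInstance, eq_bot_or_eq_top := fun N => ?_ }
  -- By Maschke's theorem a submodule `N` has an equivariant projection. Viewed as an endomorphism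
  -- it is a scalar `c`, so `N` is zero or everything according to whether `c = 0`.
  obtain ⟨p, hp⟩ := MonoidAlgebra.exists_leftInverse_of_injective N.subtype N.ker_subtype
  obtain ⟨c, hc⟩ := (finrank_eq_one_iff_of_nonzero' _ hid).1 h
    ((Representation.IntertwiningMap.equivLinearMapAsModule ρ ρ).symm (N.subtype ∘ₗ p))
  have hcv : ∀ v : V, ((p (v : ρ.asModule) : N) : ρ.asModule) = (c • v : V) := fun v =>
    (DFunLike.congr_fun hc v).symm
  have hpv : ∀ v : N, p v = v := fun v => LinearMap.congr_fun hp v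
  by_cases h0 : c = 0
  · left
    rw [eq_bot_iff]
    intro v hv
    have h1 := hcv v
    rw [hpv ⟨v, hv⟩, h0] at h1
    exact h1.trans (zero_smul ℂ (v : V))
  · right
    rw [eq_top_iff]
    suffices H : ∀ w : V, (show ρ.asModule from w) ∈ N from fun v _ => H v
    intro w
    have h1 := hcv (c⁻¹ • w)
    rw [smul_inv_smul₀ h0 w] at h1
    exact h1 ▸ (p _).2

lemma isIrreducibleCharacter_of_finrank {G V : Type*} [Group G] [Finite G]
    [AddCommGroup V] [Module ℂ V] [FiniteDimensional ℂ V] (ρ : Representation ℂ G V)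
    (h : Module.finrank ℂ (Representation.IntertwiningMap ρ ρ) = 1) :
    IsIrreducibleCharacter ρ.character := by
  let e : V ≃ₗ[ℂ] (Fin (Module.finrank ℂ V) → ℂ) := (Module.finBasis ℂ V).equivFun
  let σ : Representation ℂ G (Fin (Module.finrank ℂ V) → ℂ) :=
    (e.conjRingEquiv : Module.End ℂ V →* _).comp ρ
  have hσ : σ.character = ρ.character := by
    ext g
    exact LinearMap.trace_conj' (ρ g) e
  refine ⟨_, σ, isIrreducible_of_finrank_intertwiningMap σ ?_, hσ⟩
  rw [finrank_intertwiningMap_eq hσ, h]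

lemma IsIrreducibleCharacter.finrank {G V : Type*} [Group G] [Finite G]
    [AddCommGroup V] [Module ℂ V] [FiniteDimensional ℂ V] {ρ : Representation ℂ G V}
    (h : IsIrreducibleCharacter ρ.character) :
    Module.finrank ℂ (Representation.IntertwiningMap ρ ρ) = 1 := by
  obtain ⟨d, σ, hσ, hχ⟩ := h
  rw [← finrank_intertwiningMap_eq hχ]
  exact Representation.IsIrreducible.finrank_intertwiningMap_self σ

end

section

open scoped commutatorElement

variable {n : ℕ} {F : Type*} [Field F]

/-! ### Evaluation of short functionals -/

lemma Fin.exists_pred {i k : Fin n} (h : (k : ℕ) = i + 2) :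
    ∃ j : Fin n, (j : ℕ) = i + 1 ∧ (k : ℕ) = j + 1 :=
  ⟨⟨i + 1, by omega⟩, rfl, h⟩

lemma IsShort.apply_lmul {l : Module.Dual F (strictUpper n F)} (hl : IsShort l)
    {g : unitriangular n F} {X : strictUpper n F}
    (h : ∀ i j k : Fin n, (j : ℕ) = i + 1 → (k : ℕ) = i + 2 →
      coef l i k * ((subOne g).1 i j * X.1 j k) = 0) : l (lmul g X) = l X := by
  refine hl.apply_eq (fun i j hij => ?_) fun i k hik => ?_
  · rw [lmul_apply_one g X hij]
  · obtain ⟨j, hj, -⟩ := Fin.exists_pred hik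
    rw [lmul_apply_two g X hj hik, mul_add, h i j k hj hik, add_zero]

lemma IsShort.apply_rmul {l : Module.Dual F (strictUpper n F)} (hl : IsShort l)
    {g : unitriangular n F} {X : strictUpper n F}
    (h : ∀ i j k : Fin n, (j : ℕ) = i + 1 → (k : ℕ) = i + 2 →
      coef l i k * (X.1 i j * (subOne g).1 j k) = 0) : l (rmul g X) = l X := by
  refine hl.apply_eq (fun i j hij => ?_) fun i k hik => ?_
  · rw [rmul_apply_one g X hij]
  · obtain ⟨j, hj, -⟩ := Fin.exists_pred hik
    rw [rmul_apply_two g X hj hik, mul_add, h i j k hj hik, add_zero]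

lemma IsShort.coef_lact_of_ne {l : Module.Dual F (strictUpper n F)} (hl : IsShort l)
    (g : unitriangular n F) {i k : Fin n} (hk : (k : ℕ) ≠ i + 1) :
    coef (lact g l) i k = coef l i k := by
  refine hl.apply_lmul fun a b c hb hc => ?_
  rw [elementary_apply_of_ne, mul_zero, mul_zero]
  rintro ⟨rfl, rfl⟩
  omega

lemma IsShort.coef_ract_of_ne {l : Module.Dual F (strictUpper n F)} (hl : IsShort l)
    (g : unitriangular n F) {i k : Fin n} (hk : (k : ℕ) ≠ i + 1) :
    coef (ract g l) i k = coef l i k := by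
  refine hl.apply_rmul fun a b c hb hc => ?_
  rw [elementary_apply_of_ne, zero_mul, mul_zero]
  rintro ⟨rfl, rfl⟩
  omega

lemma IsShort.isShort_lact {l : Module.Dual F (strictUpper n F)} (hl : IsShort l)
    (g : unitriangular n F) : IsShort (lact g l) := fun i j hij => by
  rw [hl.coef_lact_of_ne g (by omega), hl i j hij]

lemma IsShort.isShort_ract {l : Module.Dual F (strictUpper n F)} (hl : IsShort l)
    (g : unitriangular n F) : IsShort (ract g l) := fun i j hij => by
  rw [hl.coef_ract_of_ne g (by omega), hl i j hij]

lemma IsShort.coef_lact_of_eq_zero {l : Module.Dual F (strictUpper n F)} (hl : IsShort l)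
    (g : unitriangular n F) {j k : Fin n}
    (h : ∀ i : Fin n, (j : ℕ) = i + 1 → (k : ℕ) = i + 2 → coef l i k = 0) :
    coef (lact g l) j k = coef l j k := by
  refine hl.apply_lmul fun a b c hb hc => ?_
  by_cases hbc : j = b ∧ k = c
  · obtain ⟨rfl, rfl⟩ := hbc
    rw [h a hb hc, zero_mul]
  · rw [elementary_apply_of_ne hbc, mul_zero, mul_zero]

/-- The product `g⁻¹E_{jk}` equals `E_{jk}` plus multiples of the `E_{ak}` with `a < j`, and a short
functional sees only the one with `a = j - 1`. Thus the left action moves a first-superdiagonal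
coefficient by a multiple of the second-superdiagonal one above it. -/
lemma IsShort.coef_lact {l : Module.Dual F (strictUpper n F)} (hl : IsShort l)
    (g : unitriangular n F) {i j k : Fin n} (hj : (j : ℕ) = i + 1) (hk : (k : ℕ) = i + 2) :
    coef (lact g l) j k = coef l j k + (subOne g⁻¹).1 i j * coef l i k := by
  rw [coef, coef, coef, ← smul_eq_mul, ← map_smul, ← map_add, lact_apply]
  refine hl.apply_eq (fun a b hb => ?_) fun a c hc => ?_
  · rw [lmul_apply_one _ _ hb, Submodule.coe_add, Submodule.coe_smul, Matrix.add_apply,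
      Matrix.smul_apply, elementary_apply_of_ne (i := i) (j := k) (by rintro ⟨rfl, rfl⟩; omega),
      smul_zero, add_zero]
  · obtain ⟨b, hb, -⟩ := Fin.exists_pred hc
    rw [lmul_apply_two _ _ hb hc, Submodule.coe_add, Submodule.coe_smul, Matrix.add_apply,
      Matrix.smul_apply, smul_eq_mul]
    by_cases h : i = a ∧ k = c
    · obtain ⟨rfl, rfl⟩ := h
      obtain rfl : j = b := Fin.ext (hj.trans hb.symm)
      rw [elementary_apply_self (by rw [Fin.lt_def]; omega),
        elementary_apply_self (by rw [Fin.lt_def]; omega)]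
    · rw [elementary_apply_of_ne h, elementary_apply_of_ne (k := b)]
      · ring
      · rintro ⟨rfl, rfl⟩
        exact h ⟨Fin.ext (by omega), rfl⟩

lemma IsShort.coef_ract {l : Module.Dual F (strictUpper n F)} (hl : IsShort l)
    (g : unitriangular n F) {i j k : Fin n} (hj : (j : ℕ) = i + 1) (hk : (k : ℕ) = i + 2) :
    coef (ract g l) i j = coef l i j + (subOne g).1 j k * coef l i k := by
  rw [coef, coef, coef, ← smul_eq_mul, ← map_smul, ← map_add, ract_apply]
  refine hl.apply_eq (fun a b hb => ?_) fun a c hc => ?_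
  · rw [rmul_apply_one _ _ hb, Submodule.coe_add, Submodule.coe_smul, Matrix.add_apply,
      Matrix.smul_apply, elementary_apply_of_ne (i := i) (j := k) (by rintro ⟨rfl, rfl⟩; omega),
      smul_zero, add_zero]
  · obtain ⟨b, hb, -⟩ := Fin.exists_pred hc
    rw [rmul_apply_two _ _ hb hc, Submodule.coe_add, Submodule.coe_smul, Matrix.add_apply,
      Matrix.smul_apply, smul_eq_mul]
    by_cases h : i = a ∧ k = c
    · obtain ⟨rfl, rfl⟩ := h
      obtain rfl : j = b := Fin.ext (hj.trans hb.symm)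
      rw [elementary_apply_self (by rw [Fin.lt_def]; omega),
        elementary_apply_self (by rw [Fin.lt_def]; omega)]
      ring
    · rw [elementary_apply_of_ne h, elementary_apply_of_ne (l := b)]
      · ring
      · rintro ⟨rfl, rfl⟩
        exact h ⟨rfl, Fin.ext (by omega)⟩

/-! ### Transvections -/

/-- The element `1 + t E_{ij}` of `Uₙ(F)`, for `i < j`. -/
def transvection (i j : Fin n) (t : F) : unitriangular n F := oneAdd (t • elementary F i j)

lemma subOne_transvection (i j : Fin n) (t : F) :
    subOne (transvection i j t) = t • elementary F i j := subOne_oneAdd _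

lemma subOne_transvection_of_ne {i j k m : Fin n} (t : F) (h : ¬ (i = k ∧ j = m)) :
    (subOne (transvection i j t)).1 k m = 0 := by
  rw [subOne_transvection, Submodule.coe_smul, Matrix.smul_apply, elementary_apply_of_ne h,
    smul_zero]

lemma subOne_transvection_self {i j : Fin n} (t : F) (h : i < j) :
    (subOne (transvection i j t)).1 i j = t := by
  rw [subOne_transvection, Submodule.coe_smul, Matrix.smul_apply, elementary_apply_self h,
    smul_eq_mul, mul_one]

lemma apply_subOne_transvection (l : Module.Dual F (strictUpper n F)) (i j : Fin n) (t : F) :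
    l (subOne (transvection i j t)) = t * coef l i j := by
  rw [subOne_transvection, map_smul, smul_eq_mul, coef]

lemma commutator_transvection {i j k : Fin n} (hij : i < j) (hjk : j < k) (a b : F) :
    ⁅transvection i j a, transvection j k b⁆ = transvection i k (a * b) := by
  rw [commutatorElement_def, mul_inv_eq_iff_eq_mul, mul_inv_eq_iff_eq_mul]
  apply Subtype.ext
  apply Units.ext
  change (1 + a • (elementary F i j).1) * (1 + b • (elementary F j k).1) =
    (1 + (a * b) • (elementary F i k).1) * (1 + b • (elementary F j k).1) *
      (1 + a • (elementary F i j).1)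
  rw [coe_elementary hij, coe_elementary hjk, coe_elementary (hij.trans hjk)]
  simp only [Matrix.smul_single, smul_eq_mul, mul_one, mul_add, add_mul, one_mul,
    Matrix.single_mul_single_same, Matrix.single_mul_single_of_ne _ _ _ _ hjk.ne',
    Matrix.single_mul_single_of_ne _ _ _ _ (hij.trans hjk).ne', zero_mul]
  abel

/-- The element is the iterated commutator of transvections at `(i,i+1)`, `(i+1,i+2)` and `(i+2,k)`
with parameters `t`, `1`, `1`; the last position needs `i + 2 < k`. -/
lemma transvection_mem {i k : Fin n} (h : (i : ℕ) + 2 < k) (t : F) :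
    transvection i k t ∈ (⁅(⊤ : Subgroup (unitriangular n F)),
      ⁅(⊤ : Subgroup (unitriangular n F)), (⊤ : Subgroup (unitriangular n F))⁆⁆ :
        Subgroup (unitriangular n F)) := by
  let j : Fin n := ⟨i + 1, by omega⟩
  let j' : Fin n := ⟨i + 2, by omega⟩
  have h1 : i < j := by rw [Fin.lt_def]; exact Nat.lt_succ_self _
  have h2 : j < j' := by rw [Fin.lt_def]; exact Nat.lt_succ_self _
  have h3 : j' < k := by rw [Fin.lt_def]; exact h
  rw [← mul_one t, ← commutator_transvection h1 (h2.trans h3), ← mul_one (1 : F),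
    ← commutator_transvection h2 h3]
  exact Subgroup.commutator_mem_commutator (Subgroup.mem_top _)
    (Subgroup.commutator_mem_commutator (Subgroup.mem_top _) (Subgroup.mem_top _))

/-! ### The lower central series -/

lemma strictUpper_mul_eq_zero {k : ℕ} (A B : strictUpper n F)
    (hB : ∀ i j : Fin n, (j : ℕ) < i + k → B.1 i j = 0) {i j : Fin n}
    (hij : (j : ℕ) < i + (k + 1)) : (A.1 * B.1) i j = 0 := by
  rw [Matrix.mul_apply]
  refine Finset.sum_eq_zero fun m _ => ?_
  rcases le_or_gt m i with h | h
  · rw [A.2 i m h, zero_mul]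
  · rw [hB m j (by rw [Fin.lt_def] at h; omega), mul_zero]

lemma mul_strictUpper_eq_zero {k : ℕ} (A B : strictUpper n F)
    (hB : ∀ i j : Fin n, (j : ℕ) < i + k → B.1 i j = 0) {i j : Fin n}
    (hij : (j : ℕ) < i + (k + 1)) : (B.1 * A.1) i j = 0 := by
  rw [Matrix.mul_apply]
  refine Finset.sum_eq_zero fun m _ => ?_
  rcases le_or_gt j m with h | h
  · rw [A.2 m j h, mul_zero]
  · rw [hB i m (by rw [Fin.lt_def] at h; omega), zero_mul]

/-- The subgroup of `Uₙ(F)` of the elements `g` with `(g - 1)_{ij} = 0` for `j < i + k`. -/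
def levelSubgroup (n : ℕ) (F : Type*) [Field F] (k : ℕ) : Subgroup (unitriangular n F) where
  carrier := {g | ∀ i j : Fin n, (j : ℕ) < i + k → (subOne g).1 i j = 0}
  one_mem' := fun i j _ => by rw [subOne_one]; rfl
  mul_mem' := by
    intro g h hg hh i j hij
    rw [subOne_mul, Submodule.coe_add, Matrix.add_apply, lmul_eq_add, Matrix.add_apply, hg i j hij,
      hh i j hij, strictUpper_mul_eq_zero _ _ hh (by omega), add_zero, add_zero]
  inv_mem' := by
    intro g hg i j hij
    have h : lmul g⁻¹ (subOne g) + subOne g⁻¹ = 0 := by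
      rw [← subOne_mul, inv_mul_cancel, subOne_one]
    rw [eq_neg_of_add_eq_zero_right h, Submodule.coe_neg, Matrix.neg_apply, lmul_eq_add,
      Matrix.add_apply, hg i j hij, strictUpper_mul_eq_zero _ _ hg (by omega), add_zero, neg_zero]

/-- From `[g,h]hg = gh` one gets `([g,h] - 1)hg = gh - hg`, which is the additive commutator of `g -
1` and `h - 1`. Its products lie one superdiagonal deeper than `h - 1`, and multiplication by
`(hg)⁻¹` does not bring them back. -/
lemma commutator_mem_levelSubgroup {k : ℕ} (g : unitriangular n F) {h : unitriangular n F}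
    (hh : h ∈ levelSubgroup n F k) : ⁅g, h⁆ ∈ levelSubgroup n F (k + 1) := by
  have hz : ⁅g, h⁆ * (h * g) = g * h := by rw [commutatorElement_def]; group
  let D : strictUpper n F := subOne (g * h) - subOne (h * g)
  have hD : rmul (h * g) (subOne ⁅g, h⁆) = D := by
    rw [eq_sub_iff_add_eq, ← subOne_mul', hz]
  have hDc : D.1 = (subOne g).1 * (subOne h).1 - (subOne h).1 * (subOne g).1 := by
    change (subOne (g * h)).1 - (subOne (h * g)).1 = _
    rw [subOne_mul, subOne_mul, Submodule.coe_add, Submodule.coe_add, lmul_eq_add, lmul_eq_add]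
    abel
  have hD0 : ∀ i j : Fin n, (j : ℕ) < i + (k + 1) → D.1 i j = 0 := fun i j hij => by
    rw [hDc, Matrix.sub_apply, strictUpper_mul_eq_zero _ _ hh hij,
      mul_strictUpper_eq_zero _ _ hh hij, sub_zero]
  have hz' : subOne ⁅g, h⁆ = rmul (h * g)⁻¹ D := by
    rw [← hD, ← rmul_mul, mul_inv_cancel, rmul_one]
  intro i j hij
  rw [hz', rmul_eq_add, Matrix.add_apply, hD0 i j hij,
    mul_strictUpper_eq_zero _ _ hD0 (by omega), add_zero]

lemma commutator_commutator_le : (⁅(⊤ : Subgroup (unitriangular n F)),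
      ⁅(⊤ : Subgroup (unitriangular n F)), (⊤ : Subgroup (unitriangular n F))⁆⁆ :
        Subgroup (unitriangular n F)) ≤ levelSubgroup n F 3 := by
  refine Subgroup.commutator_le.2 fun g _ h hh => commutator_mem_levelSubgroup g ?_
  refine (Subgroup.commutator_le (H₃ := levelSubgroup n F 2)).2 (fun g _ h _ =>
    commutator_mem_levelSubgroup g ?_) hh
  exact fun i j hij => (subOne h).2 i j (by rw [Fin.le_def]; omega)

/-! ### Functionals of Heisenberg type -/

/-- `λ` is a sum of terms `c_i X_{i,i+2}` and `a_i X_{i,i+1}` where consecutive `c_i` are not both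
nonzero. -/
structure IsNoncrossing (l : Module.Dual F (strictUpper n F)) : Prop where
  short : IsShort l
  noncrossing : ∀ i j k m : Fin n, (j : ℕ) = i + 1 → (k : ℕ) = i + 2 → (m : ℕ) = i + 3 →
    coef l i k ≠ 0 → coef l j m = 0

/-- The functionals attached to labeled Pell paths: in addition `a_i = a_{i+1} = 0` when
`c_i ≠ 0`. -/
structure IsPathFunctional (l : Module.Dual F (strictUpper n F)) : Prop extends
    IsNoncrossing l where
  left : ∀ i j k : Fin n, (j : ℕ) = i + 1 → (k : ℕ) = i + 2 → coef l i k ≠ 0 → coef l i j = 0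
  right : ∀ i j k : Fin n, (j : ℕ) = i + 1 → (k : ℕ) = i + 2 → coef l i k ≠ 0 → coef l j k = 0

lemma coef_neg (l : Module.Dual F (strictUpper n F)) (i j : Fin n) :
    coef (-l) i j = -coef l i j := rfl

lemma IsShort.neg {l : Module.Dual F (strictUpper n F)} (hl : IsShort l) : IsShort (-l) :=
  fun i j hij => by rw [coef_neg, hl i j hij, neg_zero]

lemma IsNoncrossing.neg {l : Module.Dual F (strictUpper n F)} (hl : IsNoncrossing l) :
    IsNoncrossing (-l) where
  short := hl.short.neg
  noncrossing i j k m hj hk hm h := by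
    rw [coef_neg, hl.noncrossing i j k m hj hk hm (neg_ne_zero.1 h), neg_zero]

lemma IsPathFunctional.neg {l : Module.Dual F (strictUpper n F)} (hl : IsPathFunctional l) :
    IsPathFunctional (-l) where
  toIsNoncrossing := hl.toIsNoncrossing.neg
  left i j k hj hk h := by rw [coef_neg, hl.left i j k hj hk (neg_ne_zero.1 h), neg_zero]
  right i j k hj hk h := by rw [coef_neg, hl.right i j k hj hk (neg_ne_zero.1 h), neg_zero]

/-- The right action clears the coefficient at `(i,i+1)` and the left action the one at `(i+1,i+2)`,
dividing by the nonzero one at `(i,i+2)`. All positions are treated at once by a single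
superdiagonal matrix on each side. -/
lemma IsNoncrossing.exists_isPathFunctional {l : Module.Dual F (strictUpper n F)}
    (hl : IsNoncrossing l) : ∃ g h, IsPathFunctional (lact g (ract h l)) := by
  -- The entry at `(j,j+1)` solves `a_{j-1} + T_{j,j+1} c_{j-1} = 0`. Division by zero gives `0`
  -- where `c_{j-1}` vanishes, and the truncated index at `j = 0` is harmless, because that entry is
  -- never used.
  let T : strictUpper n F := ⟨fun j k => if (k : ℕ) = j + 1 then
    -(coef l ⟨j - 1, by omega⟩ j / coef l ⟨j - 1, by omega⟩ k) else 0, fun i j hij =>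
      if_neg (by rw [Fin.le_def] at hij; omega)⟩
  let l₁ := ract (oneAdd T) l
  have hs := hl.short
  have hs₁ : IsShort l₁ := hs.isShort_ract _
  have hc₁ : ∀ i k : Fin n, (k : ℕ) = i + 2 → coef l₁ i k = coef l i k := fun i k hk =>
    hs.coef_ract_of_ne _ (by omega)
  have ha₁ : ∀ i j k : Fin n, (j : ℕ) = i + 1 → (k : ℕ) = i + 2 → coef l i k ≠ 0 →
      coef l₁ i j = 0 := fun i j k hj hk h => by
    have hT : T.1 j k = -(coef l i j / coef l i k) := by
      have : (⟨j - 1, by omega⟩ : Fin n) = i := Fin.ext (by simp [hj])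
      change (if (k : ℕ) = j + 1 then _ else _) = _
      rw [if_pos (by omega), this]
    rw [hs.coef_ract _ hj hk, subOne_oneAdd, hT]
    field_simp
    ring
  -- The entry at `(i,i+1)` solves `a_{i+1} + S_{i,i+1} c_i = 0` for the new functional. The minimum
  -- only keeps the index in range: it equals `i + 2` wherever the entry is used.
  let S : strictUpper n F := ⟨fun i j => if (j : ℕ) = i + 1 then
    -(coef l₁ j ⟨min (i + 2) (n - 1), by omega⟩ / coef l₁ i ⟨min (i + 2) (n - 1), by omega⟩) else 0,
      fun i j hij => if_neg (by rw [Fin.le_def] at hij; omega)⟩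
  let l₂ := lact (oneAdd S)⁻¹ l₁
  have hc₂ : ∀ i k : Fin n, (k : ℕ) = i + 2 → coef l₂ i k = coef l i k := fun i k hk => by
    rw [hs₁.coef_lact_of_ne _ (by omega), hc₁ i k hk]
  refine ⟨(oneAdd S)⁻¹, oneAdd T, ⟨⟨hs₁.isShort_lact _, fun i j k m hj hk hm h => ?_⟩,
    fun i j k hj hk h => ?_, fun i j k hj hk h => ?_⟩⟩
  · rw [hc₂ i k hk] at h
    rw [hc₂ j m (by omega), hl.noncrossing i j k m hj hk hm h]
  · rw [hc₂ i k hk] at h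
    -- The left step could spoil the zero already obtained at `(i,j)` only through a nonzero
    -- coefficient at `(i-1,i+1)`, which the noncrossing condition excludes.
    rw [hs₁.coef_lact_of_eq_zero, ha₁ i j k hj hk h]
    intro i' hi' hj'
    rw [hc₁ i' j hj']
    by_contra h'
    exact h (hl.noncrossing i' i j k hi' hj' (by omega) h')
  · rw [hc₂ i k hk] at h
    have hS : S.1 i j = -(coef l₁ j k / coef l₁ i k) := by
      have : (⟨min (i + 2) (n - 1), by omega⟩ : Fin n) = k := Fin.ext (by simp; omega)
      change (if (j : ℕ) = i + 1 then _ else _) = _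
      rw [if_pos hj, this]
    rw [← hc₁ i k hk] at h
    rw [hs₁.coef_lact _ hj hk, inv_inv, subOne_oneAdd, hS]
    field_simp
    ring

end

section

variable {n : ℕ} {F : Type*} [Field F]

/-! ### Transvections acting on short functionals -/

lemma IsShort.lact_transvection {l : Module.Dual F (strictUpper n F)} (hl : IsShort l)
    {i j : Fin n} (t : F)
    (h : ∀ k : Fin n, (j : ℕ) = i + 1 → (k : ℕ) = i + 2 → coef l i k = 0) :
    lact (transvection i j t)⁻¹ l = l := by
  ext X
  rw [lact_apply, inv_inv]
  refine hl.apply_lmul fun a b c hb hc => ?_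
  by_cases hab : i = a ∧ j = b
  · obtain ⟨rfl, rfl⟩ := hab
    rw [h c hb hc, zero_mul]
  · rw [subOne_transvection_of_ne t hab, zero_mul, mul_zero]

lemma IsShort.apply_lmul_transvection {l : Module.Dual F (strictUpper n F)} (hl : IsShort l)
    {i j k : Fin n} (hj : (j : ℕ) = i + 1) (hk : (k : ℕ) = i + 2) (t : F)
    (X : strictUpper n F) :
    l (lmul (transvection i j t) X) = l X + t * X.1 j k * coef l i k := by
  rw [coef, ← smul_eq_mul _ (l _), ← map_smul, ← map_add]
  refine hl.apply_eq (fun a b hb => ?_) fun a c hc => ?_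
  · rw [lmul_apply_one _ _ hb, Submodule.coe_add, Submodule.coe_smul, Matrix.add_apply,
      Matrix.smul_apply, elementary_apply_of_ne (by rintro ⟨rfl, rfl⟩; omega), smul_zero, add_zero]
  · obtain ⟨b, hb, -⟩ := Fin.exists_pred hc
    rw [lmul_apply_two _ _ hb hc, Submodule.coe_add, Submodule.coe_smul, Matrix.add_apply,
      Matrix.smul_apply, smul_eq_mul]
    by_cases h : i = a
    · subst h
      obtain rfl : j = b := Fin.ext (hj.trans hb.symm)
      obtain rfl : k = c := Fin.ext (hk.trans hc.symm)
      rw [elementary_apply_self (by rw [Fin.lt_def]; omega),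
        subOne_transvection_self _ (by rw [Fin.lt_def]; omega), mul_one]
    · rw [elementary_apply_of_ne (fun h' => h h'.1),
        subOne_transvection_of_ne t (fun h' => h h'.1), zero_mul, mul_zero]

lemma IsShort.apply_rmul_transvection {l : Module.Dual F (strictUpper n F)} (hl : IsShort l)
    {i j k : Fin n} (hj : (j : ℕ) = i + 1) (hk : (k : ℕ) = i + 2) (t : F)
    (X : strictUpper n F) :
    l (rmul (transvection j k t) X) = l X + t * X.1 i j * coef l i k := by
  rw [coef, ← smul_eq_mul _ (l _), ← map_smul, ← map_add]
  refine hl.apply_eq (fun a b hb => ?_) fun a c hc => ?_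
  · rw [rmul_apply_one _ _ hb, Submodule.coe_add, Submodule.coe_smul, Matrix.add_apply,
      Matrix.smul_apply, elementary_apply_of_ne (by rintro ⟨rfl, rfl⟩; omega), smul_zero, add_zero]
  · obtain ⟨b, hb, hbc⟩ := Fin.exists_pred hc
    rw [rmul_apply_two _ _ hb hc, Submodule.coe_add, Submodule.coe_smul, Matrix.add_apply,
      Matrix.smul_apply, smul_eq_mul]
    by_cases h : k = c
    · subst h
      obtain rfl : i = a := Fin.ext (by omega)
      obtain rfl : j = b := Fin.ext (by omega)
      rw [elementary_apply_self (by rw [Fin.lt_def]; omega),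
        subOne_transvection_self _ (by rw [Fin.lt_def]; omega)]
      ring
    · rw [elementary_apply_of_ne (fun h' => h h'.2),
        subOne_transvection_of_ne t (fun h' => h h'.2), mul_zero, mul_zero]

variable [Finite F]

/-! ### Endomorphisms of `ℂG v_λ` -/

lemma orbitVector_smul_ne {θ : AddChar F ℂ} (hθ : θ ≠ 1) {l : Module.Dual F (strictUpper n F)}
    {m m' : leftOrbit l} {a b : ℂ} (hb : b ≠ 0)
    (h : a • orbitVector θ l m = b • orbitVector θ l m') : m = m' := by
  by_contra hne
  apply hb
  rw [← orbitBasis_apply hθ, ← orbitBasis_apply hθ] at h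
  have := congrArg (fun x => (orbitBasis hθ l).repr x m') h
  simpa [Finsupp.single_apply, hne] using this.symm

/-- Right multiplication by `h⁻¹` commutes with the left action and sends `v_λ` to a multiple of
`v_{λh}`. If `λh` lies in the left orbit, it preserves `ℂG v_λ`; being then a scalar, it cannot move
`v_λ` to another basis vector. -/
lemma ract_eq_of_finrank {θ : AddChar F ℂ} (hθ : θ ≠ 1) {l : Module.Dual F (strictUpper n F)}
    (hl : Module.finrank ℂ (Representation.IntertwiningMap (superRep θ l) (superRep θ l)) = 1)
    (h : unitriangular n F) (hh : ract h l ∈ leftOrbit l) : ract h l = l := by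
  let s : MonoidAlgebra ℂ (unitriangular n F) := MonoidAlgebra.single h⁻¹ 1
  have hs : superVector θ l * s = θ (l (subOne h)) • superVector θ (ract h l) := by
    have := superVector_mul_single θ l h⁻¹
    rwa [inv_inv] at this
  have hmem : ∀ x ∈ superModule θ l, x * s ∈ superModule θ l := by
    intro x hx
    obtain ⟨a, rfl⟩ := Submodule.mem_span_singleton.1 hx
    rw [smul_mul_assoc, hs]
    exact Submodule.smul_mem _ _ (Submodule.smul_of_tower_mem _ _ (superVector_mem hh))
  let f : Representation.IntertwiningMap (superRep θ l) (superRep θ l) :=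
    { toFun := fun x => ⟨x.1 * s, hmem _ x.2⟩
      map_add' := fun x y => Subtype.ext (add_mul _ _ _)
      map_smul' := fun c x => Subtype.ext (smul_mul_assoc c x.1 s)
      isIntertwining' := fun g => LinearMap.ext fun x => Subtype.ext (mul_assoc _ _ _) }
  have hid : Representation.IntertwiningMap.id (superRep θ l) ≠ 0 := by
    intro h0
    have h1 := DFunLike.congr_fun h0 (orbitBasis hθ l ⟨l, self_mem_leftOrbit l⟩)
    exact (orbitBasis hθ l).ne_zero _ h1
  obtain ⟨c, hc⟩ := (finrank_eq_one_iff_of_nonzero' _ hid).1 hl f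
  have h1 : c • orbitVector θ l ⟨l, self_mem_leftOrbit l⟩ =
      θ (l (subOne h)) • orbitVector θ l ⟨ract h l, hh⟩ :=
    (DFunLike.congr_fun hc (orbitVector θ l ⟨l, self_mem_leftOrbit l⟩)).trans (Subtype.ext hs)
  exact (congrArg Subtype.val (orbitVector_smul_ne hθ (θ.val_isUnit _).ne_zero h1)).symm

/-- The matrix of `g` is monomial, so at a fixed point of the permutation the coordinate is only
rescaled. -/
lemma repr_superRep {θ : AddChar F ℂ} (hθ : θ ≠ 1) {l : Module.Dual F (strictUpper n F)}
    (g : unitriangular n F) (m : leftOrbit l) (hm : lact g m.1 = m.1) (x : superModule θ l) :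
    (orbitBasis hθ l).repr (superRep θ l g x) m =
      θ (m.1 (subOne g⁻¹)) * (orbitBasis hθ l).repr x m := by
  have h : (orbitBasis hθ l).coord m ∘ₗ superRep θ l g =
      θ (m.1 (subOne g⁻¹)) • (orbitBasis hθ l).coord m := by
    refine (orbitBasis hθ l).ext fun m' => ?_
    rw [LinearMap.comp_apply, orbitBasis_apply, superRep_orbitVector, ← orbitBasis_apply hθ,
      ← orbitBasis_apply hθ, map_smul, LinearMap.smul_apply]
    by_cases hmm : m' = m
    · subst hmm
      simp [hm]
    · have : lact g m'.1 ≠ m.1 := fun h => hmm (Subtype.ext (by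
        rw [← lact_one m'.1, ← inv_mul_cancel g, lact_mul, h, ← hm, ← lact_mul, inv_mul_cancel,
          lact_one, hm]))
      simp [hmm, this, Subtype.ext_iff]
  exact LinearMap.congr_fun h x

/-- An endomorphism is determined by the image of the generator `v_λ`. That image is an eigenvector
of every `g` fixing `λ`, with the eigenvalue of `v_λ`; a `g` that also fixes `m` but has another
eigenvalue at `v_m` forces its `m`-coordinate to vanish. -/
lemma finrank_eq_one_of_separated {θ : AddChar F ℂ} (hθ : θ ≠ 1)
    {l : Module.Dual F (strictUpper n F)}
    (h : ∀ m ∈ leftOrbit l, m ≠ l → ∃ g, lact g m = m ∧ lact g l = l ∧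
      θ (m (subOne g⁻¹)) ≠ θ (l (subOne g⁻¹))) :
    Module.finrank ℂ (Representation.IntertwiningMap (superRep θ l) (superRep θ l)) = 1 := by
  let o : leftOrbit l := ⟨l, self_mem_leftOrbit l⟩
  let b := orbitBasis hθ l
  refine finrank_eq_one (Representation.IntertwiningMap.id (superRep θ l)) ?_ fun f => ?_
  · intro h0
    exact b.ne_zero o (DFunLike.congr_fun h0 (b o))
  have hf0 : f (b o) = b.repr (f (b o)) o • b o := by
    apply b.ext_elem
    intro m
    by_cases hm : m = o
    · subst hm; simp
    · obtain ⟨g, hgm, hgl, hne⟩ := h m.1 m.2 fun h => hm (Subtype.ext h)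
      have h1 : superRep θ l g (b o) = θ (l (subOne g⁻¹)) • b o := by
        change superRep θ l g (orbitBasis hθ l o) = _ • orbitBasis hθ l o
        rw [orbitBasis_apply, superRep_orbitVector]
        congr 2
        exact Subtype.ext hgl
      have h2 := repr_superRep hθ g m hgm (f (b o))
      rw [← f.isIntertwining, h1, map_smul, map_smul, Finsupp.smul_apply, smul_eq_mul] at h2
      have h3 : b.repr (f (b o)) m = 0 := by
        by_contra h3
        exact hne (mul_right_cancel₀ h3 h2).symm
      rw [h3]
      simp [Ne.symm hm]
  refine ⟨b.repr (f (b o)) o, ?_⟩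
  set c := b.repr (f (b o)) o
  refine Representation.IntertwiningMap.ext (b.ext fun m => ?_)
  obtain ⟨_, g, rfl⟩ := m
  have h1 : superRep θ l g (b o) = θ (l (subOne g⁻¹)) • b ⟨lact g l, g, rfl⟩ := by
    change superRep θ l g (orbitBasis hθ l o) = _ • orbitBasis hθ l _
    rw [orbitBasis_apply, orbitBasis_apply, superRep_orbitVector]
  have h2 : b ⟨lact g l, g, rfl⟩ = (θ (l (subOne g⁻¹)))⁻¹ • superRep θ l g (b o) := by
    rw [h1, inv_smul_smul₀ (θ.val_isUnit _).ne_zero]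
  change c • b ⟨lact g l, g, rfl⟩ = f (b ⟨lact g l, g, rfl⟩)
  rw [h2, map_smul, f.isIntertwining, hf0, map_smul, smul_comm]

/-- A point of the orbit can differ from `λ` only at some `(i,i+1)` whose neighbor `(i-1,i+1)` has a
nonzero coefficient. Then the coefficient at `(i,i+2)` is zero, so transvections at `(i,i+1)` fix
both functionals, and a suitable parameter separates them. -/
lemma IsNoncrossing.finrank {θ : AddChar F ℂ} (hθ : θ ≠ 1)
    {l : Module.Dual F (strictUpper n F)} (hl : IsNoncrossing l) :
    Module.finrank ℂ (Representation.IntertwiningMap (superRep θ l) (superRep θ l)) = 1 := by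
  refine finrank_eq_one_of_separated hθ ?_
  rintro _ ⟨x, rfl⟩ hne
  dsimp only at hne ⊢
  have hs := hl.short
  obtain ⟨i, j, hij, hc⟩ : ∃ i j : Fin n, i < j ∧ coef (lact x l) i j ≠ coef l i j := by
    by_contra! H
    exact hne (dual_ext H)
  have hj : (j : ℕ) = i + 1 := by
    by_contra hj
    exact hc (hs.coef_lact_of_ne x hj)
  obtain ⟨a, ha, haj, hcaj⟩ : ∃ a : Fin n, (i : ℕ) = a + 1 ∧ (j : ℕ) = a + 2 ∧ coef l a j ≠ 0 := by
    by_contra! H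
    exact hc (hs.coef_lact_of_eq_zero x H)
  have h0 : ∀ k : Fin n, (k : ℕ) = i + 2 → coef l i k = 0 := fun k hk =>
    hl.noncrossing a i j k ha haj (by omega) hcaj
  obtain ⟨t, ht⟩ := exists_smul_addChar_ne hθ hc
  refine ⟨(transvection i j t)⁻¹, (hs.isShort_lact x).lact_transvection t fun k _ hk => ?_,
    hs.lact_transvection t fun k _ hk => h0 k hk, ?_⟩
  · rw [hs.coef_lact_of_ne x (by omega), h0 k hk]
  · rwa [inv_inv, apply_subOne_transvection, apply_subOne_transvection]

/-- With `c_i ≠ 0`, the right transvection at `(k,m)` and a left one at `(i,j)` both add a multiple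
of `X_{jk}`. The ratio of the two coefficients makes the effects equal, so the right translate lies
in the left orbit and must be `λ` itself; hence `c_j = 0`. -/
lemma IsShort.isNoncrossing_of_finrank {θ : AddChar F ℂ} (hθ : θ ≠ 1)
    {l : Module.Dual F (strictUpper n F)} (hs : IsShort l)
    (hl : Module.finrank ℂ (Representation.IntertwiningMap (superRep θ l) (superRep θ l)) = 1) :
    IsNoncrossing l := by
  refine ⟨hs, fun i j k m hj hk hm h => ?_⟩
  have h1 : ract (transvection k m 1) l =
      lact (transvection i j (coef l j m / coef l i k))⁻¹ l := by
    ext X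
    rw [ract_apply, lact_apply, inv_inv, hs.apply_lmul_transvection hj hk,
      hs.apply_rmul_transvection (i := j) (by omega) (by omega)]
    field_simp
  have h2 := ract_eq_of_finrank hθ hl (transvection k m 1) ⟨_, h1.symm⟩
  have h3 := hs.coef_ract (transvection k m 1) (i := j) (j := k) (k := m) (by omega) (by omega)
  rw [h2, subOne_transvection_self _ (by rw [Fin.lt_def]; omega), one_mul] at h3
  simpa using h3

/-! ### Kernels of the supercharacters -/

/-- Under the hypothesis `g` acts on every basis vector by the same scalar. -/
lemma superRep_character_of_central {θ : AddChar F ℂ} (hθ : θ ≠ 1)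
    {l : Module.Dual F (strictUpper n F)} {g : unitriangular n F}
    (h : ∀ m ∈ leftOrbit l, lact g m = m ∧ m (subOne g⁻¹) = l (subOne g⁻¹)) :
    (superRep θ l).character g = (superRep θ l).character 1 * θ (l (subOne g⁻¹)) := by
  classical
  let _ := Fintype.ofFinite (Module.Dual F (strictUpper n F))
  rw [superRep_character hθ, superRep_character hθ, Finset.sum_mul]
  refine Finset.sum_congr rfl fun m _ => ?_
  by_cases hm : m ∈ leftOrbit l
  · rw [if_pos ⟨hm, (h m hm).1⟩, if_pos ⟨hm, lact_one m⟩, (h m hm).2, inv_one, subOne_one, map_zero,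
      AddChar.map_zero_eq_one, one_mul]
  · rw [if_neg (fun h => hm h.1), if_neg (fun h => hm h.1), zero_mul]

lemma superRep_character_one_ne_zero {θ : AddChar F ℂ} (hθ : θ ≠ 1)
    (l : Module.Dual F (strictUpper n F)) : (superRep θ l).character 1 ≠ 0 := by
  have : Nontrivial (superModule θ l) :=
    ⟨_, 0, (orbitBasis hθ l).ne_zero ⟨l, self_mem_leftOrbit l⟩⟩
  rw [Representation.char_one]
  exact Nat.cast_ne_zero.2 Module.finrank_pos.ne'

lemma IsShort.superRep_character_of_mem {θ : AddChar F ℂ} (hθ : θ ≠ 1)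
    {l : Module.Dual F (strictUpper n F)} (hl : IsShort l) {g : unitriangular n F}
    (hg : g ∈ levelSubgroup n F 3) :
    (superRep θ l).character g = (superRep θ l).character 1 := by
  have hg' := inv_mem hg
  have h0 : ∀ m : Module.Dual F (strictUpper n F), IsShort m → m (subOne g⁻¹) = 0 := by
    intro m hm
    rw [← map_zero m]
    exact hm.apply_eq (fun i j hij => by rw [hg' i j (by omega)]; rfl)
      fun i j hij => by rw [hg' i j (by omega)]; rfl
  rw [superRep_character_of_central hθ, h0 l hl, AddChar.map_zero_eq_one, mul_one]
  rintro _ ⟨x, rfl⟩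
  refine ⟨?_, (h0 _ (hl.isShort_lact x)).trans (h0 l hl).symm⟩
  ext X
  exact (hl.isShort_lact x).apply_lmul fun i j k hj _ => by
    rw [hg' i j (by omega), zero_mul, mul_zero]

/-- At `1` every orbit element contributes `1`, while at `g` it contributes `0` or a number of
modulus one. Equality of the sums forces equality of the real parts term by term, in particular at
`λ`, and modulus one with real part one means the value is one. -/
lemma apply_eq_one_of_superRep_character_eq {θ : AddChar F ℂ} (hθ : θ ≠ 1)
    {l : Module.Dual F (strictUpper n F)} {g : unitriangular n F}
    (h : (superRep θ l).character g = (superRep θ l).character 1) : θ (l (subOne g⁻¹)) = 1 := by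
  classical
  let _ := Fintype.ofFinite (Module.Dual F (strictUpper n F))
  rw [superRep_character hθ, superRep_character hθ] at h
  have hre := congrArg Complex.re h
  rw [Complex.re_sum, Complex.re_sum] at hre
  have hle : ∀ m ∈ (Finset.univ : Finset (Module.Dual F (strictUpper n F))),
      (if m ∈ leftOrbit l ∧ lact g m = m then θ (m (subOne g⁻¹)) else 0).re ≤
      (if m ∈ leftOrbit l ∧ lact 1 m = m then θ (m (subOne 1⁻¹)) else 0).re := by
    intro m _
    by_cases hm : m ∈ leftOrbit l
    · rw [if_pos (c := m ∈ leftOrbit l ∧ lact 1 m = m) ⟨hm, lact_one m⟩, inv_one,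
        subOne_one, map_zero, AddChar.map_zero_eq_one]
      split_ifs
      · exact (Complex.re_le_norm _).trans (AddChar.norm_apply θ _).le
      · simp
    · rw [if_neg (fun h => hm h.1), if_neg (fun h => hm h.1)]
  have heq := (Finset.sum_eq_sum_iff_of_le hle).1 hre l (Finset.mem_univ l)
  rw [if_pos (c := l ∈ leftOrbit l ∧ lact 1 l = l) ⟨self_mem_leftOrbit l, lact_one l⟩, inv_one,
    subOne_one, map_zero, AddChar.map_zero_eq_one] at heq
  split_ifs at heq
  · have hn := AddChar.norm_apply θ (l (subOne g⁻¹))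
    rw [Complex.one_re] at heq
    have hsq := Complex.sq_norm (θ (l (subOne g⁻¹)))
    rw [hn, Complex.normSq_apply, heq] at hsq
    apply Complex.ext
    · rw [heq, Complex.one_re]
    · rw [Complex.one_im]
      nlinarith
  · simp at heq

lemma isShort_of_superRep_character {θ : AddChar F ℂ} (hθ : θ ≠ 1)
    {l : Module.Dual F (strictUpper n F)}
    (h : ∀ g ∈ (⁅(⊤ : Subgroup (unitriangular n F)),
      ⁅(⊤ : Subgroup (unitriangular n F)), (⊤ : Subgroup (unitriangular n F))⁆⁆ :
        Subgroup (unitriangular n F)), (superRep θ l).character g =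
      (superRep θ l).character 1) : IsShort l := by
  intro i j hij
  by_contra hc
  obtain ⟨t, ht⟩ := exists_smul_addChar_ne hθ hc
  apply ht
  have h1 := apply_eq_one_of_superRep_character_eq hθ (h _ (inv_mem (transvection_mem hij t)))
  rw [inv_inv, apply_subOne_transvection] at h1
  rw [h1, mul_zero, AddChar.map_zero_eq_one]

/-! ### Heisenberg supercharacters and path functionals -/

lemma superchar_mem_of_isPathFunctional {θ : AddChar F ℂ} (hθ : θ ≠ 1)
    {l : Module.Dual F (strictUpper n F)} (hl : IsPathFunctional l) :
    superchar θ l ∈ heisenbergSupercharacters n θ := by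
  refine ⟨⟨l, rfl⟩, ?_, fun g hg => ?_⟩
  · rw [superchar_eq_character hθ]
    exact isIrreducibleCharacter_of_finrank _ (hl.neg.toIsNoncrossing.finrank hθ)
  · rw [superchar_eq_character hθ]
    exact hl.neg.short.superRep_character_of_mem hθ (commutator_commutator_le hg)

lemma exists_isPathFunctional_of_mem {θ : AddChar F ℂ} (hθ : θ ≠ 1)
    {χ : unitriangular n F → ℂ} (hχ : χ ∈ heisenbergSupercharacters n θ) :
    ∃ l, IsPathFunctional l ∧ superchar θ l = χ := by
  obtain ⟨⟨l, rfl⟩, hirr, hker⟩ := hχ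
  rw [superchar_eq_character hθ] at hirr hker
  have hs := isShort_of_superRep_character hθ hker
  -- Since `superchar θ l` is the character of the module of `-l`, the normal form is taken for `-l`
  -- and then negated.
  obtain ⟨g, h, hp⟩ := (hs.isNoncrossing_of_finrank hθ hirr.finrank).exists_isPathFunctional
  refine ⟨_, hp.neg, ?_⟩
  rw [superchar_eq_character hθ, superchar_eq_character hθ, neg_neg, superRep_character_lact hθ,
    superRep_character_ract hθ]

/-- The hypotheses make every transvection at `(i,j)` act as the scalar `θ(t λ(E_{ij}))`, so the
character reveals the coefficient. They concern only `j = i + 1` and are vacuous elsewhere. -/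
lemma IsShort.coef_eq_of_superRep_character {θ : AddChar F ℂ} (hθ : θ ≠ 1)
    {l m : Module.Dual F (strictUpper n F)} (hl : IsShort l) (hm : IsShort m)
    (h : (superRep θ l).character = (superRep θ m).character) {i j : Fin n}
    (hij : ∀ k : Fin n, (j : ℕ) = i + 1 → (k : ℕ) = i + 2 → coef l i k = 0 ∧ coef m i k = 0)
    (hij' : ∀ k : Fin n, (j : ℕ) = i + 1 → (i : ℕ) = k + 1 → coef l k j = 0 ∧ coef m k j = 0) :
    coef l i j = coef m i j := by
  have key : ∀ l : Module.Dual F (strictUpper n F), IsShort l →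
      (∀ k : Fin n, (j : ℕ) = i + 1 → (k : ℕ) = i + 2 → coef l i k = 0) →
      (∀ k : Fin n, (j : ℕ) = i + 1 → (i : ℕ) = k + 1 → coef l k j = 0) → ∀ t : F,
      (superRep θ l).character (transvection i j t)⁻¹ =
        (superRep θ l).character 1 * θ (t * coef l i j) := by
    intro l hl h1 h2 t
    rw [superRep_character_of_central hθ, inv_inv, apply_subOne_transvection]
    rintro _ ⟨x, rfl⟩
    refine ⟨(hl.isShort_lact x).lact_transvection t fun k hj hk => ?_, ?_⟩
    · rw [hl.coef_lact_of_ne x (by omega), h1 k hj hk]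
    · rw [inv_inv, apply_subOne_transvection, apply_subOne_transvection]
      by_cases hj : (j : ℕ) = i + 1
      · rw [hl.coef_lact_of_eq_zero x fun k hk _ => h2 k hj hk]
      · rw [hl.coef_lact_of_ne x hj]
  by_contra hc
  obtain ⟨t, ht⟩ := exists_smul_addChar_ne hθ hc
  apply ht
  have h1 := key l hl (fun k hj hk => (hij k hj hk).1) (fun k hj hk => (hij' k hj hk).1) t
  rw [h, key m hm (fun k hj hk => (hij k hj hk).2) (fun k hj hk => (hij' k hj hk).2) t] at h1
  exact (mul_left_cancel₀ (superRep_character_one_ne_zero hθ m) h1).symm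

/-- The coefficients off the first superdiagonal are read off directly. One on the first
superdiagonal is zero for both functionals next to a nonzero coefficient of the second
superdiagonal, and can be read off otherwise. -/
lemma IsPathFunctional.eq_of_superchar_eq {θ : AddChar F ℂ} (hθ : θ ≠ 1)
    {l m : Module.Dual F (strictUpper n F)} (hl : IsPathFunctional l) (hm : IsPathFunctional m)
    (h : superchar θ l = superchar θ m) : l = m := by
  rw [superchar_eq_character hθ, superchar_eq_character hθ] at h
  apply neg_injective
  replace hl := hl.neg
  replace hm := hm.neg
  have hc : ∀ i k : Fin n, (k : ℕ) ≠ i + 1 → coef (-l) i k = coef (-m) i k := fun i k hk =>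
    hl.short.coef_eq_of_superRep_character hθ hm.short h (fun _ h _ => absurd h hk)
      fun _ h _ => absurd h hk
  refine dual_ext fun i j _ => ?_
  by_cases hj : (j : ℕ) = i + 1
  · by_cases h1 : ∃ k : Fin n, (k : ℕ) = i + 2 ∧ coef (-l) i k ≠ 0
    · obtain ⟨k, hk, hk0⟩ := h1
      rw [hl.left i j k hj hk hk0, hm.left i j k hj hk (by rwa [← hc i k (by omega)])]
    · by_cases h2 : ∃ k : Fin n, (i : ℕ) = k + 1 ∧ coef (-l) k j ≠ 0
      · obtain ⟨k, hk, hk0⟩ := h2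
        rw [hl.right k i j hk (by omega) hk0,
          hm.right k i j hk (by omega) (by rwa [← hc k j (by omega)])]
      · push Not at h1 h2
        refine hl.short.coef_eq_of_superRep_character hθ hm.short h (fun k _ hk => ?_)
          fun k _ hk => ?_
        · rw [← hc i k (by omega)]
          exact ⟨h1 k hk, h1 k hk⟩
        · rw [← hc k j (by omega)]
          exact ⟨h2 k hk, h2 k hk⟩
  · exact hc i j hj

end

section

/-! ### Set partitions and their arcs -/

section Arcs

variable {n : ℕ}

lemma IsArc.reflTransGen {p : Finpartition (Finset.univ : Finset (Fin n))}
    {B : Finset (Fin n)} (hB : B ∈ p.parts) {i j : Fin n} (hi : i ∈ B) (hj : j ∈ B) (hij : i ≤ j) :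
    Relation.ReflTransGen (IsArc p) i j := by
  induction h : (j : ℕ) - i using Nat.strong_induction_on generalizing i with
  | _ d ih =>
    rcases hij.eq_or_lt with rfl | hlt
    · exact .refl
    · have hne : (B.filter (i < ·)).Nonempty := ⟨j, Finset.mem_filter.2 ⟨hj, hlt⟩⟩
      obtain ⟨hkB, hik⟩ := Finset.mem_filter.1 (Finset.min'_mem _ hne)
      have hmin : ∀ m ∈ B, i < m → (B.filter (i < ·)).min' hne ≤ m := fun m hm him =>
        Finset.min'_le _ _ (Finset.mem_filter.2 ⟨hm, him⟩)
      refine .head ⟨B, hB, hi, hkB, hik, hmin⟩ (ih _ ?_ hkB (hmin j hj hlt) rfl)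
      have := Fin.lt_def.1 hik
      have := Fin.lt_def.1 hlt
      omega

/-- Arcs join consecutive elements of a block, so each block is one chain of arcs. Hence the arcs
determine the partition. -/
lemma mem_part_iff_reflTransGen {p : Finpartition (Finset.univ : Finset (Fin n))} {i j : Fin n} :
    i ∈ p.part j ↔
      Relation.ReflTransGen (IsArc p) i j ∨ Relation.ReflTransGen (IsArc p) j i := by
  have hr : ∀ i j : Fin n, Relation.ReflTransGen (IsArc p) i j → i ∈ p.part j := by
    intro i j h
    induction h with
    | refl => exact p.mem_part_self.2 (Finset.mem_univ _)
    | tail _ hab ih =>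
      obtain ⟨B, hB, ha, hb, -⟩ := hab
      rw [p.part_eq_of_mem hB ha] at ih
      rwa [p.part_eq_of_mem hB hb]
  constructor
  · rw [p.mem_part_iff_exists]
    rintro ⟨B, hB, hi, hj⟩
    rcases le_total i j with h | h
    · exact Or.inl (IsArc.reflTransGen hB hi hj h)
    · exact Or.inr (IsArc.reflTransGen hB hj hi h)
  · rintro (h | h)
    · exact hr i j h
    · have := hr j i h
      rw [p.mem_part_iff_exists] at this ⊢
      obtain ⟨B, hB, hi, hj⟩ := this
      exact ⟨B, hB, hj, hi⟩

lemma finpartition_eq_of_isArc_iff {p p' : Finpartition (Finset.univ : Finset (Fin n))}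
    (h : ∀ i j, IsArc p i j ↔ IsArc p' i j) : p = p' := by
  have harc : IsArc p = IsArc p' := by
    ext i j
    exact h i j
  have hpart : p.part = p'.part := by
    funext j
    ext i
    rw [mem_part_iff_reflTransGen, mem_part_iff_reflTransGen, harc]
  apply Finpartition.ext
  ext B
  have key : ∀ q q' : Finpartition (Finset.univ : Finset (Fin n)), q.part = q'.part →
      B ∈ q.parts → B ∈ q'.parts := by
    intro q q' hqq hB
    obtain ⟨a, ha⟩ := q.nonempty_of_mem_parts hB
    rw [← q.part_eq_of_mem hB ha, hqq]
    exact q'.part_mem.2 (Finset.mem_univ a)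
  exact ⟨key p p' hpart, key p' p hpart.symm⟩

/-- With at most one successor and one predecessor for each element, the connected components of `R`
are chains. Two elements reachable from a common one, or reaching a common one, are comparable,
which gives transitivity. As `R` increases, the successor in a chain is the next larger element of
the block. -/
lemma exists_finpartition_isArc {R : Fin n → Fin n → Prop} (hlt : ∀ i j, R i j → i < j)
    (hr : ∀ i j k, R i j → R i k → j = k) (hl : ∀ i j k, R i k → R j k → i = j) :
    ∃ p : Finpartition (Finset.univ : Finset (Fin n)), ∀ i j, IsArc p i j ↔ R i j := by
  classical
  have hr' : Relator.RightUnique R := fun i j k => hr i j k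
  have hl' : Relator.RightUnique (Function.swap R) := fun k i j => hl i j k
  let s : Setoid (Fin n) :=
    { r := fun i j => Relation.ReflTransGen R i j ∨ Relation.ReflTransGen R j i
      iseqv :=
        { refl := fun i => Or.inl .refl
          symm := fun h => h.symm
          trans := by
            intro i j k
            rintro (h | h) (h' | h')
            · exact Or.inl (h.trans h')
            · have := Relation.ReflTransGen.total_of_right_unique hl'
                (Relation.reflTransGen_swap.2 h) (Relation.reflTransGen_swap.2 h')
              exact this.symm.imp Relation.reflTransGen_swap.1 Relation.reflTransGen_swap.1
            · exact Relation.ReflTransGen.total_of_right_unique hr' h h'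
            · exact Or.inr (h'.trans h) } }
  have hle : ∀ i j, Relation.ReflTransGen R i j → i ≤ j := by
    intro i j h
    induction h with
    | refl => exact le_rfl
    | tail _ hab ih => exact ih.trans (hlt _ _ hab).le
  let p := Finpartition.ofSetoid s
  have hp : ∀ i j B, B ∈ p.parts → i ∈ B → (j ∈ B ↔
      Relation.ReflTransGen R i j ∨ Relation.ReflTransGen R j i) := by
    intro i j B hB hi
    rw [← p.part_eq_of_mem hB hi]
    exact Finpartition.mem_part_ofSetoid_iff_rel
  refine ⟨p, fun i j => ⟨?_, fun h => ?_⟩⟩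
  · rintro ⟨B, hB, hi, hj, hij, hmin⟩
    rcases (hp i j B hB hi).1 hj with h | h
    · rcases h.cases_head with rfl | ⟨k, hik, hkj⟩
      · exact absurd hij (lt_irrefl _)
      · have hk : k ∈ B := (hp i k B hB hi).2 (Or.inl (.single hik))
        rwa [le_antisymm (hmin k hk (hlt _ _ hik)) (hle _ _ hkj)]
    · exact absurd hij (hle _ _ h).not_gt
  · have hB := p.part_mem.2 (Finset.mem_univ i)
    have hi := p.mem_part_self.2 (Finset.mem_univ i)
    refine ⟨_, hB, hi, (hp i j _ hB hi).2 (Or.inl (.single h)), hlt _ _ h, fun k hk hik => ?_⟩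
    rcases (hp i k _ hB hi).1 hk with h' | h'
    · rcases h'.cases_head with rfl | ⟨m, him, hmk⟩
      · exact absurd hik (lt_irrefl _)
      · rw [hr _ _ _ h him]
        exact hle _ _ hmk
    · exact absurd hik (hle _ _ h').not_gt

end Arcs

variable {n : ℕ} {F : Type*} [Field F]

lemma LabeledPartition.ext_label {L L' : LabeledPartition n F}
    (h : ∀ i j, L.label i j = L'.label i j) : L = L' := by
  apply LabeledPartition.ext
  · apply finpartition_eq_of_isArc_iff
    intro i j
    rw [← L.label_ne_zero_iff, ← L'.label_ne_zero_iff, h]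
  · funext i j
    exact h i j

lemma LabeledPartition.coef_functional (L : LabeledPartition n F) {i j : Fin n} (hij : i < j) :
    coef L.functional i j = L.label i j := by
  change ∑ a, ∑ b, L.label a b * (elementary F i j).1 a b = _
  rw [Finset.sum_eq_single i, Finset.sum_eq_single j, elementary_apply_self hij, mul_one]
  · intro b _ hb
    rw [elementary_apply_of_ne (fun h => hb h.2.symm), mul_zero]
  · simp
  · intro a _ ha
    refine Finset.sum_eq_zero fun b _ => ?_
    rw [elementary_apply_of_ne (fun h => ha h.1.symm), mul_zero]
  · simp

/-! ### Labeled Pell paths -/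

/-- The length `x + y` of a step. -/
def LabeledStep.size {S : Set (ℕ × ℕ)} (s : LabeledStep F S) : ℕ := s.step.1 + s.step.2

/-- The label of a step that has one, and zero otherwise. -/
def LabeledStep.value {S : Set (ℕ × ℕ)} (s : LabeledStep F S) : F :=
  if h : s.step.2 = 1 then s.label ⟨0, by omega⟩ else 0

/-- The value `x + y` at the end of a path. -/
def pathLength {S : Set (ℕ × ℕ)} (P : List (LabeledStep F S)) : ℕ :=
  (endpoint P).1 + (endpoint P).2

/-- The step `(1, 0)`. -/
def flatStep (F : Type*) [Field F] : LabeledStep F pellSteps :=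
  ⟨(1, 0), by simp [pellSteps], Fin.elim0⟩

/-- The step `(0, 1)` with label `t`. -/
def upStep (t : Fˣ) : LabeledStep F pellSteps := ⟨(0, 1), by simp [pellSteps], fun _ => t⟩

/-- The step `(1, 1)` with label `t`. -/
def diagStep (t : Fˣ) : LabeledStep F pellSteps := ⟨(1, 1), by simp [pellSteps], fun _ => t⟩

lemma LabeledStep.cases (s : LabeledStep F pellSteps) :
    s = flatStep F ∨ (∃ t, s = upStep t) ∨ ∃ t, s = diagStep t := by
  obtain ⟨⟨a, b⟩, hs, f⟩ := s
  have h := hs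
  simp only [pellSteps, Set.mem_insert_iff, Set.mem_singleton_iff, Prod.mk.injEq] at h
  rcases h with ⟨rfl, rfl⟩ | ⟨rfl, rfl⟩ | ⟨rfl, rfl⟩
  · left
    rw [flatStep]
    congr
    funext k
    exact k.elim0
  · right; right
    refine ⟨f 0, ?_⟩
    rw [diagStep]
    congr
    funext k
    rw [Subsingleton.elim k 0]
  · right; left
    refine ⟨f 0, ?_⟩
    rw [upStep]
    congr
    funext k
    rw [Subsingleton.elim k 0]

@[simp] lemma size_flatStep : (flatStep F).size = 1 := rfl
@[simp] lemma size_upStep (t : Fˣ) : (upStep t).size = 1 := rfl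
@[simp] lemma size_diagStep (t : Fˣ) : (diagStep t).size = 2 := rfl
@[simp] lemma value_flatStep : (flatStep F).value = 0 := rfl
@[simp] lemma value_upStep (t : Fˣ) : (upStep t).value = t := rfl
@[simp] lemma value_diagStep (t : Fˣ) : (diagStep t).value = t := rfl

lemma upStep_injective : Function.Injective (upStep (F := F)) := fun a b h =>
  Units.ext (by rw [← value_upStep a, h, value_upStep])

lemma diagStep_injective : Function.Injective (diagStep (F := F)) := fun a b h =>
  Units.ext (by rw [← value_diagStep a, h, value_diagStep])

lemma flatStep_ne_upStep (t : Fˣ) : flatStep F ≠ upStep t := fun h => by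
  have := congrArg LabeledStep.value h
  exact t.ne_zero this.symm

lemma LabeledStep.size_pos (s : LabeledStep F pellSteps) : 0 < s.size := by
  rcases s.cases with rfl | ⟨t, rfl⟩ | ⟨t, rfl⟩ <;> simp

lemma LabeledStep.value_eq_iff (s : LabeledStep F pellSteps) (t : Fˣ) :
    s.value = t ↔ ∃ k, s.label k = t := by
  rcases s.cases with rfl | ⟨u, rfl⟩ | ⟨u, rfl⟩
  · constructor
    · intro h
      exact absurd h.symm t.ne_zero
    · rintro ⟨k, -⟩
      exact Fin.elim0 k
  · rw [value_upStep, Units.val_inj]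
    exact ⟨fun h => ⟨(0 : Fin 1), h⟩, fun ⟨_, h⟩ => h⟩
  · rw [value_diagStep, Units.val_inj]
    exact ⟨fun h => ⟨(0 : Fin 1), h⟩, fun ⟨_, h⟩ => h⟩

@[simp] lemma pathLength_nil : pathLength ([] : List (LabeledStep F pellSteps)) = 0 := rfl

@[simp] lemma pathLength_cons (s : LabeledStep F pellSteps) (P : List (LabeledStep F pellSteps)) :
    pathLength (s :: P) = s.size + pathLength P := by
  simp only [pathLength, endpoint, List.map_cons, List.sum_cons, Prod.fst_add, Prod.snd_add,
    LabeledStep.size]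
  omega

/-- The label of the step of `P` that leads from the line `x + y = i` to the line `x + y = j`, and
zero if there is no such step or if it is unlabeled. -/
def pathLabel : List (LabeledStep F pellSteps) → ℕ → ℕ → F
  | [], _, _ => 0
  | s :: P, i, j =>
    if i < s.size then if i = 0 ∧ j = s.size then s.value else 0
    else pathLabel P (i - s.size) (j - s.size)

lemma pathLabel_cons_of_lt {s : LabeledStep F pellSteps} {P : List (LabeledStep F pellSteps)}
    {i j : ℕ} (h : i < s.size) :
    pathLabel (s :: P) i j = if i = 0 ∧ j = s.size then s.value else 0 := by
  rw [pathLabel, if_pos h]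

lemma pathLabel_cons_of_le {s : LabeledStep F pellSteps} {P : List (LabeledStep F pellSteps)}
    {i j : ℕ} (h : s.size ≤ i) :
    pathLabel (s :: P) i j = pathLabel P (i - s.size) (j - s.size) := by
  rw [pathLabel, if_neg h.not_gt]

lemma pathLabel_cons_add (s : LabeledStep F pellSteps) (P : List (LabeledStep F pellSteps))
    (i j : ℕ) : pathLabel (s :: P) (i + s.size) (j + s.size) = pathLabel P i j := by
  rw [pathLabel_cons_of_le (Nat.le_add_left _ _), Nat.add_sub_cancel, Nat.add_sub_cancel]

lemma pathLabel_eq_iff (P : List (LabeledStep F pellSteps)) (i j : ℕ) (t : Fˣ) :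
    pathLabel P i j = t ↔ ∃ P₁ P₂ s, P = P₁ ++ s :: P₂ ∧ pathLength P₁ = i ∧ j = i + s.size ∧
      s.value = (t : F) := by
  induction P generalizing i j with
  | nil =>
    constructor
    · intro h
      exact absurd h.symm t.ne_zero
    · rintro ⟨P₁, P₂, s, h, -⟩
      simp at h
  | cons s P ih =>
    rcases lt_or_ge i s.size with h | h
    · rw [pathLabel_cons_of_lt h]
      constructor
      · intro h1
        split_ifs at h1 with h2
        · exact ⟨[], P, s, rfl, h2.1.symm, by omega, h1⟩
        · exact absurd h1.symm t.ne_zero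
      · rintro ⟨P₁, P₂, s', hP, hi, hj, hv⟩
        cases P₁ with
        | nil =>
          simp only [List.nil_append, List.cons.injEq] at hP
          obtain ⟨rfl, rfl⟩ := hP
          rw [if_pos ⟨hi.symm, by rw [hj, ← hi]; simp⟩, hv]
        | cons a P₁ =>
          simp only [List.cons_append, List.cons.injEq] at hP
          rw [pathLength_cons, ← hP.1] at hi
          omega
    · rw [pathLabel_cons_of_le h, ih]
      constructor
      · rintro ⟨P₁, P₂, s', hP, hi, hj, hv⟩
        have := s'.size_pos
        exact ⟨s :: P₁, P₂, s', by rw [hP]; rfl, by rw [pathLength_cons]; omega, by omega, hv⟩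
      · rintro ⟨P₁, P₂, s', hP, hi, hj, hv⟩
        cases P₁ with
        | nil =>
          have := s.size_pos
          rw [pathLength_nil] at hi
          omega
        | cons a P₁ =>
          simp only [List.cons_append, List.cons.injEq] at hP
          rw [pathLength_cons, ← hP.1] at hi
          exact ⟨P₁, P₂, s', hP.2, by omega, by omega, hv⟩

/-- Counted from zero, the arc `(i,j)` records the levels `x + y` at the two ends of the step. The
height gain of one required here holds for every labeled Pell step. -/
lemma hasLabeledStep_iff (P : List (LabeledStep F pellSteps)) (i j : ℕ) (t : Fˣ) :
    (∃ x x' y : ℕ, HasLabeledStep P (x, y) (x', y + 1) t ∧ i + 1 = x + (y + 1) ∧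
      j + 1 = x' + (y + 1) + 1) ↔ pathLabel P i j = t := by
  rw [pathLabel_eq_iff]
  constructor
  · rintro ⟨x, x', y, ⟨P₁, P₂, s, hP, he, hs, hk⟩, hi, hj⟩
    refine ⟨P₁, P₂, s, hP, ?_, ?_, (s.value_eq_iff t).2 hk⟩
    · rw [pathLength, he]
      dsimp only
      omega
    · have h1 := congrArg Prod.fst hs
      have h2 := congrArg Prod.snd hs
      simp only [Prod.fst_add, Prod.snd_add] at h1 h2
      rw [LabeledStep.size]
      omega
  · rintro ⟨P₁, P₂, s, hP, hi, hj, hv⟩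
    have hk := (s.value_eq_iff t).1 hv
    have hs : s.step.2 = 1 := by
      by_contra h
      rw [LabeledStep.value, dif_neg h] at hv
      exact t.ne_zero hv.symm
    rw [LabeledStep.size] at hj
    rw [pathLength] at hi
    exact ⟨(endpoint P₁).1, (endpoint P₁).1 + s.step.1, (endpoint P₁).2,
      ⟨P₁, P₂, s, hP, rfl, Prod.ext rfl (by simp [hs]), hk⟩, by omega, by omega⟩

/-! ### Label functions of Pell paths -/

/-- The label functions of the Pell paths of length `N`. -/
structure IsPellLabel (N : ℕ) (f : ℕ → ℕ → F) : Prop where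
  supp : ∀ i j, f i j ≠ 0 → (j = i + 1 ∨ j = i + 2) ∧ j ≤ N
  left : ∀ i, f i (i + 2) ≠ 0 → f i (i + 1) = 0
  right : ∀ i, f i (i + 2) ≠ 0 → f (i + 1) (i + 2) = 0
  noncrossing : ∀ i, f i (i + 2) ≠ 0 → f (i + 1) (i + 3) = 0

lemma isPellLabel_pathLabel (P : List (LabeledStep F pellSteps)) :
    IsPellLabel (pathLength P) (pathLabel P) := by
  induction P with
  | nil => exact ⟨fun i j h => absurd rfl h, fun i h => absurd rfl h, fun i h => absurd rfl h,
      fun i h => absurd rfl h⟩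
  | cons s P ih =>
    have hs := s.size_pos
    have hs2 : s.size = 1 ∨ s.size = 2 := by
      rcases s.cases with rfl | ⟨t, rfl⟩ | ⟨t, rfl⟩ <;> simp
    have hshift : ∀ i k, s.size ≤ i → pathLabel (s :: P) i (i + k) =
        pathLabel P (i - s.size) (i - s.size + k) := fun i k hi => by
      rw [pathLabel_cons_of_le hi]
      congr 1
      omega
    have hfst : ∀ i k, i < s.size → pathLabel (s :: P) i k ≠ 0 → i = 0 ∧ k = s.size :=
      fun i k hi h => by
        rw [pathLabel_cons_of_lt hi] at h
        by_contra h'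
        exact h (if_neg h')
    refine ⟨fun i j h => ?_, fun i h => ?_, fun i h => ?_, fun i h => ?_⟩
    · rw [pathLength_cons]
      rcases lt_or_ge i s.size with hi | hi
      · have := hfst i j hi h
        omega
      · rw [pathLabel_cons_of_le hi] at h
        have := ih.supp _ _ h
        omega
    · rcases lt_or_ge i s.size with hi | hi
      · by_contra h'
        have := hfst i _ hi h
        have := hfst i _ hi h'
        omega
      · rw [hshift i _ hi] at h ⊢
        exact ih.left _ h
    · rcases lt_or_ge i s.size with hi | hi
      · by_contra h'
        have := hfst i _ hi h
        have := hfst (i + 1) _ (by omega) h'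
        omega
      · rw [hshift i _ hi] at h
        rw [hshift (i + 1) 1 (by omega), show i + 1 - s.size = i - s.size + 1 by omega]
        exact ih.right _ h
    · rcases lt_or_ge i s.size with hi | hi
      · by_contra h'
        have := hfst i _ hi h
        have := hfst (i + 1) _ (by omega) h'
        omega
      · rw [hshift i _ hi] at h
        rw [hshift (i + 1) 2 (by omega), show i + 1 - s.size = i - s.size + 1 by omega]
        exact ih.noncrossing _ h

/-- The first step is visible at `(0,1)` and `(0,2)`: a nonzero value in one of them gives an up or
a diagonal step with its label, and two zeros give the flat step. -/
lemma LabeledStep.eq_of_pathLabel {s s' : LabeledStep F pellSteps}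
    {P P' : List (LabeledStep F pellSteps)}
    (h : ∀ i j, pathLabel (s :: P) i j = pathLabel (s' :: P') i j) : s = s' := by
  have h1 := h 0 1
  have h2 := h 0 2
  rw [pathLabel_cons_of_lt s.size_pos, pathLabel_cons_of_lt s'.size_pos] at h1 h2
  rcases s.cases with rfl | ⟨t, rfl⟩ | ⟨t, rfl⟩ <;>
    rcases s'.cases with rfl | ⟨t', rfl⟩ | ⟨t', rfl⟩ <;>
    simp [eq_comm] at h1 h2 ⊢
  · rw [Units.ext h1]
  · rw [Units.ext h2]

/-- Equality of lengths is essential, because flat steps at the end leave no trace in the labels. -/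
lemma eq_of_pathLabel_eq {P P' : List (LabeledStep F pellSteps)}
    (hlen : pathLength P = pathLength P') (h : ∀ i j, pathLabel P i j = pathLabel P' i j) :
    P = P' := by
  induction P generalizing P' with
  | nil =>
    cases P' with
    | nil => rfl
    | cons s' P' =>
      have := s'.size_pos
      rw [pathLength_nil, pathLength_cons] at hlen
      omega
  | cons s P ih =>
    cases P' with
    | nil =>
      have := s.size_pos
      rw [pathLength_nil, pathLength_cons] at hlen
      omega
    | cons s' P' =>
      obtain rfl := LabeledStep.eq_of_pathLabel h
      rw [pathLength_cons, pathLength_cons] at hlen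
      rw [ih (P' := P') (by omega) fun i j => by rw [← pathLabel_cons_add s, h, pathLabel_cons_add]]

lemma IsPellLabel.shift {N k : ℕ} {f : ℕ → ℕ → F} (hf : IsPellLabel (N + k) f) :
    IsPellLabel N fun i j => f (i + k) (j + k) where
  supp i j h := by
    have := hf.supp _ _ h
    omega
  left i h := by
    rw [show i + 2 + k = i + k + 2 by omega] at h
    rw [show i + 1 + k = i + k + 1 by omega]
    exact hf.left _ h
  right i h := by
    rw [show i + 2 + k = i + k + 2 by omega] at h ⊢
    rw [show i + 1 + k = i + k + 1 by omega]
    exact hf.right _ h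
  noncrossing i h := by
    rw [show i + 2 + k = i + k + 2 by omega] at h
    rw [show i + 1 + k = i + k + 1 by omega, show i + 3 + k = i + k + 3 by omega]
    exact hf.noncrossing _ h

lemma IsPellLabel.cons {N : ℕ} {f : ℕ → ℕ → F} {s : LabeledStep F pellSteps}
    (hf : IsPellLabel (N + s.size) f)
    (h0 : ∀ i j, i < s.size → f i j = if i = 0 ∧ j = s.size then s.value else 0)
    (h : ∃ P, pathLength P = N ∧ ∀ i j, pathLabel P i j = f (i + s.size) (j + s.size)) :
    ∃ P, pathLength P = N + s.size ∧ ∀ i j, pathLabel P i j = f i j := by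
  obtain ⟨P, hP, hPf⟩ := h
  refine ⟨s :: P, by rw [pathLength_cons, hP, add_comm], fun i j => ?_⟩
  rcases lt_or_ge i s.size with hi | hi
  · rw [pathLabel_cons_of_lt hi, h0 i j hi]
  · rw [pathLabel_cons_of_le hi, hPf, Nat.sub_add_cancel hi]
    rcases lt_or_ge j s.size with hj | hj
    · rw [Nat.sub_eq_zero_of_le hj.le, zero_add]
      have hz : ∀ k, k ≤ s.size → f i k = 0 := fun k hk => by
        by_contra hne
        have := hf.supp _ _ hne
        omega
      rw [hz _ le_rfl, hz _ hj.le]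
    · rw [Nat.sub_add_cancel hj]

/-- The first step is chosen from `f 0 2` and `f 0 1`, and the rest comes from the shifted function.
After a diagonal step, the three exclusion conditions at `0` clear all other values in the two rows
consumed. -/
lemma IsPellLabel.exists_path {N : ℕ} {f : ℕ → ℕ → F} (hf : IsPellLabel N f) :
    ∃ P : List (LabeledStep F pellSteps), pathLength P = N ∧ ∀ i j, pathLabel P i j = f i j := by
  induction N using Nat.strong_induction_on generalizing f with
  | _ N ih =>
    have hsupp : ∀ i j, ¬ ((j = i + 1 ∨ j = i + 2) ∧ j ≤ N) → f i j = 0 := fun i j h => by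
      by_contra h'
      exact h (hf.supp i j h')
    by_cases h2 : f 0 2 = 0
    · rcases Nat.eq_zero_or_pos N with rfl | hN
      · exact ⟨[], rfl, fun i j => (hsupp i j (by omega)).symm⟩
      · obtain ⟨M, rfl⟩ : ∃ M, N = M + 1 := ⟨N - 1, by omega⟩
        have key : ∀ s : LabeledStep F pellSteps, s.size = 1 → s.value = f 0 1 →
            ∃ P, pathLength P = M + 1 ∧ ∀ i j, pathLabel P i j = f i j := by
          intro s hs hv
          rw [← hs]
          rw [← hs] at hf ih
          refine hf.cons (fun i j hi => ?_) (ih M (by have := s.size_pos; omega) hf.shift)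
          obtain rfl : i = 0 := by omega
          by_cases hj : j = 1
          · rw [if_pos ⟨rfl, by omega⟩, hv, hj]
          · rw [if_neg (by omega)]
            by_cases hj2 : j = 2
            · rw [hj2, h2]
            · exact hsupp _ _ (by omega)
        by_cases h1 : f 0 1 = 0
        · exact key (flatStep F) rfl h1.symm
        · exact key (upStep (Units.mk0 _ h1)) rfl rfl
    · have hN : 2 ≤ N := (hf.supp 0 2 h2).2
      obtain ⟨M, rfl⟩ : ∃ M, N = M + 2 := ⟨N - 2, by omega⟩
      refine hf.cons (s := diagStep (Units.mk0 _ h2)) (fun i j hi => ?_)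
        (ih M (by omega) (hf.shift (k := 2)))
      rw [size_diagStep] at hi ⊢
      by_cases hij : i = 0 ∧ j = 2
      · rw [if_pos hij, hij.1, hij.2]
        rfl
      · rw [if_neg hij]
        by_contra hne
        obtain ⟨h3, -⟩ := hf.supp _ _ hne
        obtain ⟨rfl, rfl⟩ | ⟨rfl, rfl⟩ | ⟨rfl, rfl⟩ :
          (i = 0 ∧ j = 1) ∨ (i = 1 ∧ j = 2) ∨ (i = 1 ∧ j = 3) := by omega
        · exact hne (hf.left 0 h2)
        · exact hne (hf.right 0 h2)
        · exact hne (hf.noncrossing 0 h2)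

/-! ### The labeled partition of a path -/

lemma LabeledPath.isPellLabel (P : LabeledPath n F pellSteps) :
    IsPellLabel (n - 1) (pathLabel P.1) := by
  have h := isPellLabel_pathLabel P.1
  have hP : pathLength P.1 + 1 = n := P.2
  rwa [show pathLength P.1 = n - 1 by omega] at h

/-- The conditions `left` and `right` of `IsPellLabel` give each element at most one outgoing and
one incoming arc, which is what makes the labeled pairs the arcs of a partition. -/
lemma exists_labeledPartition (P : LabeledPath n F pellSteps) :
    ∃ L : LabeledPartition n F, ∀ i j : Fin n, L.label i j = pathLabel P.1 i j := by
  have hf := P.isPellLabel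
  obtain ⟨p, hp⟩ := exists_finpartition_isArc
    (R := fun i j : Fin n => pathLabel P.1 i j ≠ 0) (fun i j h => by
      have := hf.supp _ _ h
      rw [Fin.lt_def]
      omega) (fun i j k h h' => by
      have hj := (hf.supp _ _ h).1
      have hk := (hf.supp _ _ h').1
      apply Fin.ext
      rcases hj with hj | hj <;> rcases hk with hk | hk
      · omega
      · rw [hk] at h'
        rw [hj] at h
        exact absurd (hf.left _ h') h
      · rw [hj] at h
        rw [hk] at h'
        exact absurd (hf.left _ h) h'
      · omega) (fun i j k h h' => by
      have hi := (hf.supp _ _ h).1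
      have hj := (hf.supp _ _ h').1
      apply Fin.ext
      rcases hi with hi | hi <;> rcases hj with hj | hj
      · omega
      · rw [hj] at h'
        rw [show (i : ℕ) = j + 1 by omega, hj] at h
        exact absurd (hf.right _ h') h
      · rw [hi] at h
        rw [show (j : ℕ) = i + 1 by omega, hi] at h'
        exact absurd (hf.right _ h) h'
      · omega)
  exact ⟨⟨p, fun i j => pathLabel P.1 i j, fun i j => (hp i j).symm⟩, fun i j => rfl⟩

/-- The labeled partition of a Pell path. -/
def pathPartition (P : LabeledPath n F pellSteps) : LabeledPartition n F :=
  (exists_labeledPartition P).choose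

lemma pathPartition_label (P : LabeledPath n F pellSteps) (i j : Fin n) :
    (pathPartition P).label i j = pathLabel P.1 i j :=
  (exists_labeledPartition P).choose_spec i j

lemma isPathPartition_iff (P : LabeledPath n F pellSteps) (L : LabeledPartition n F) :
    IsPathPartition P L ↔ L = pathPartition P := by
  have h : IsPathPartition P L ↔
      ∀ (i j : Fin n) (t : Fˣ), L.label i j = t ↔ pathLabel P.1 i j = t := by
    refine forall_congr' fun i => forall_congr' fun j => forall_congr' fun t => ?_
    rw [hasLabeledStep_iff, ← L.label_ne_zero_iff]
    have : (L.label i j ≠ 0 ∧ L.label i j = t) ↔ L.label i j = t :=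
      ⟨fun h => h.2, fun h => ⟨h ▸ t.ne_zero, h⟩⟩
    rw [this]
  rw [h]
  constructor
  · intro h
    apply LabeledPartition.ext_label
    intro i j
    rw [pathPartition_label]
    by_cases h0 : pathLabel P.1 i j = 0
    · by_contra h1
      rw [h0] at h1
      have := (h i j (Units.mk0 _ h1)).1 rfl
      exact (Units.mk0 _ h1).ne_zero (this.symm.trans h0)
    · exact (h i j (Units.mk0 _ h0)).2 rfl
  · rintro rfl i j t
    rw [pathPartition_label]

lemma coef_pathPartition (P : LabeledPath n F pellSteps) (i j : Fin n) :
    coef (pathPartition P).functional i j = pathLabel P.1 i j := by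
  rcases lt_or_ge i j with h | h
  · rw [LabeledPartition.coef_functional _ h, pathPartition_label]
  · rw [coef_eq_zero_of_le _ h]
    by_contra h'
    have := P.isPellLabel.supp _ _ (Ne.symm h')
    rw [Fin.le_def] at h
    omega

lemma isPathFunctional_pathPartition (P : LabeledPath n F pellSteps) :
    IsPathFunctional (pathPartition P).functional where
  short i j h := by
    rw [coef_pathPartition]
    by_contra h'
    have := P.isPellLabel.supp _ _ h'
    omega
  noncrossing i j k m hj hk hm h := by
    rw [coef_pathPartition, hk] at h
    rw [coef_pathPartition, hj, hm]
    exact P.isPellLabel.noncrossing _ h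
  left i j k hj hk h := by
    rw [coef_pathPartition, hk] at h
    rw [coef_pathPartition, hj]
    exact P.isPellLabel.left _ h
  right i j k hj hk h := by
    rw [coef_pathPartition, hk] at h
    rw [coef_pathPartition, hj, hk]
    exact P.isPellLabel.right _ h

lemma pathPartition_functional_injective :
    Function.Injective fun P : LabeledPath n F pellSteps => (pathPartition P).functional := by
  intro P P' h
  dsimp only at h
  apply Subtype.ext
  have hP : pathLength P.1 + 1 = n := P.2
  have hP' : pathLength P'.1 + 1 = n := P'.2
  refine eq_of_pathLabel_eq (by omega) fun i j => ?_
  by_cases hij : i < n ∧ j < n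
  · have h1 := coef_pathPartition P ⟨i, hij.1⟩ ⟨j, hij.2⟩
    rw [h, coef_pathPartition] at h1
    exact h1.symm
  -- Outside the range of `Fin n` the functional gives no information, but there the labels vanish
  -- by the bound `j ≤ n - 1`.
  · have key : ∀ Q : LabeledPath n F pellSteps, pathLabel Q.1 i j = 0 := fun Q => by
      by_contra hQ
      have := Q.isPellLabel.supp _ _ hQ
      omega
    rw [key P, key P']

lemma IsPathFunctional.exists_path {l : Module.Dual F (strictUpper n F)}
    (hl : IsPathFunctional l) (hn : 1 ≤ n) :
    ∃ P : LabeledPath n F pellSteps, (pathPartition P).functional = l := by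
  let f : ℕ → ℕ → F := fun i j =>
    if h : i < n ∧ j < n then coef l ⟨i, h.1⟩ ⟨j, h.2⟩ else 0
  have hf0 : ∀ i j (hi : i < n) (hj : j < n), f i j = coef l ⟨i, hi⟩ ⟨j, hj⟩ :=
    fun i j hi hj => dif_pos ⟨hi, hj⟩
  have hlt : ∀ i j, f i j ≠ 0 → i < n ∧ j < n := fun i j h => by
    by_contra h'
    exact h (dif_neg h')
  have hf : IsPellLabel (n - 1) f := by
    refine ⟨fun i j h => ?_, fun i h => ?_, fun i h => ?_, fun i h => ?_⟩
    · obtain ⟨hi, hj⟩ := hlt i j h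
      rw [hf0 i j hi hj] at h
      have h1 : i < j := by
        by_contra h'
        exact h (coef_eq_zero_of_le l (Fin.le_def.2 (not_lt.1 h')))
      have h2 : j ≤ i + 2 := by
        by_contra h'
        exact h (hl.short _ _ (not_le.1 h'))
      omega
    · obtain ⟨hi, hj⟩ := hlt _ _ h
      rw [hf0 _ _ hi hj] at h
      rw [hf0 _ _ hi (by omega)]
      exact hl.left _ _ _ rfl rfl h
    · obtain ⟨hi, hj⟩ := hlt _ _ h
      rw [hf0 _ _ hi hj] at h
      rw [hf0 _ _ (by omega) hj]
      exact hl.right _ _ _ rfl rfl h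
    · obtain ⟨hi, hj⟩ := hlt _ _ h
      by_contra h'
      obtain ⟨hi', hj'⟩ := hlt _ _ h'
      rw [hf0 _ _ hi hj] at h
      rw [hf0 _ _ hi' hj'] at h'
      exact h' (hl.noncrossing _ _ _ _ rfl rfl rfl h)
  obtain ⟨P, hP, hPf⟩ := hf.exists_path
  have hP' : (endpoint P).1 + (endpoint P).2 + 1 = n := by
    rw [pathLength] at hP
    omega
  exact ⟨⟨P, hP'⟩, dual_ext fun i j _ => (coef_pathPartition _ i j).trans
    ((hPf i j).trans (hf0 i j i.2 j.2))⟩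

theorem bijOn_pathPartition [Finite F] {θ : AddChar F ℂ} (hθ : θ ≠ 1) (hn : 1 ≤ n) :
    Set.BijOn (fun P : LabeledPath n F pellSteps => superchar θ (pathPartition P).functional)
      Set.univ (heisenbergSupercharacters n θ) := by
  refine ⟨fun P _ => superchar_mem_of_isPathFunctional hθ (isPathFunctional_pathPartition P),
    fun P _ P' _ h => pathPartition_functional_injective
      ((isPathFunctional_pathPartition P).eq_of_superchar_eq hθ
        (isPathFunctional_pathPartition P') h), fun χ hχ => ?_⟩
  obtain ⟨l, hl, rfl⟩ := exists_isPathFunctional_of_mem hθ hχ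
  obtain ⟨P, rfl⟩ := hl.exists_path hn
  exact ⟨P, Set.mem_univ _, rfl⟩

end

/-! ### Delannoy numbers -/

/-- The lattice paths from the origin to `(a, b)` with steps `(1,0)`, `(1,1)`, `(0,1)`. -/
def delannoyPaths (a b : ℕ) : Set (List (ℕ × ℕ)) :=
  {P | (∀ s ∈ P, s ∈ pellSteps) ∧ P.sum = (a, b)}

/-- Removing the first step is the source of all the Delannoy recurrences below. -/
lemma mem_delannoyPaths_cons {a b : ℕ} {s : ℕ × ℕ} {P : List (ℕ × ℕ)} :
    s :: P ∈ delannoyPaths a b ↔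
      (s = (1, 0) ∧ ∃ a', a = a' + 1 ∧ P ∈ delannoyPaths a' b) ∨
      (s = (0, 1) ∧ ∃ b', b = b' + 1 ∧ P ∈ delannoyPaths a b') ∨
      (s = (1, 1) ∧ ∃ a' b', a = a' + 1 ∧ b = b' + 1 ∧ P ∈ delannoyPaths a' b') := by
  simp only [delannoyPaths, Set.mem_ofPred_eq, List.forall_mem_cons, List.sum_cons, Prod.ext_iff,
    Prod.fst_add, Prod.snd_add]
  constructor
  · rintro ⟨⟨hs, hP⟩, h1, h2⟩
    simp only [pellSteps, Set.mem_insert_iff, Set.mem_singleton_iff] at hs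
    rcases hs with rfl | rfl | rfl
    · exact Or.inl ⟨⟨rfl, rfl⟩, P.sum.1, by omega, hP, rfl, by omega⟩
    · exact Or.inr (Or.inr ⟨⟨rfl, rfl⟩, P.sum.1, P.sum.2, by omega, by omega, hP, rfl, rfl⟩)
    · exact Or.inr (Or.inl ⟨⟨rfl, rfl⟩, P.sum.2, by omega, hP, by omega, rfl⟩)
  · rintro (⟨h, a', ha, hP, h1, h2⟩ | ⟨h, b', hb, hP, h1, h2⟩ | ⟨h, a', b', ha, hb, hP, h1, h2⟩)
    · exact ⟨⟨by simp [pellSteps, Prod.ext_iff, h], hP⟩, by omega, by omega⟩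
    · exact ⟨⟨by simp [pellSteps, Prod.ext_iff, h], hP⟩, by omega, by omega⟩
    · exact ⟨⟨by simp [pellSteps, Prod.ext_iff, h], hP⟩, by omega, by omega⟩

lemma nil_mem_delannoyPaths {a b : ℕ} : [] ∈ delannoyPaths a b ↔ a = 0 ∧ b = 0 := by
  simp [delannoyPaths, Prod.ext_iff, eq_comm]

lemma delannoyPaths_zero_zero : delannoyPaths 0 0 = {[]} := by
  ext P
  cases P with
  | nil => simp [nil_mem_delannoyPaths]
  | cons s P => simp [mem_delannoyPaths_cons]

lemma delannoyPaths_zero_succ (b : ℕ) :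
    delannoyPaths 0 (b + 1) = List.cons (0, 1) '' delannoyPaths 0 b := by
  ext P
  cases P with
  | nil => simp [nil_mem_delannoyPaths]
  | cons s P => simp [mem_delannoyPaths_cons, eq_comm, and_comm]

lemma delannoyPaths_succ_zero (a : ℕ) :
    delannoyPaths (a + 1) 0 = List.cons (1, 0) '' delannoyPaths a 0 := by
  ext P
  cases P with
  | nil => simp [nil_mem_delannoyPaths]
  | cons s P => simp [mem_delannoyPaths_cons, eq_comm, and_comm]

lemma delannoyPaths_succ_succ (a b : ℕ) : delannoyPaths (a + 1) (b + 1) =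
    List.cons (1, 0) '' delannoyPaths a (b + 1) ∪ (List.cons (0, 1) '' delannoyPaths (a + 1) b ∪
      List.cons (1, 1) '' delannoyPaths a b) := by
  ext P
  cases P with
  | nil => simp [nil_mem_delannoyPaths]
  | cons s P => simp [mem_delannoyPaths_cons, eq_comm, and_comm]

lemma finite_delannoyPaths (a b : ℕ) : (delannoyPaths a b).Finite := by
  induction a generalizing b with
  | zero =>
    induction b with
    | zero => rw [delannoyPaths_zero_zero]; exact Set.finite_singleton _
    | succ b ih => rw [delannoyPaths_zero_succ]; exact ih.image _
  | succ a iha =>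
    induction b with
    | zero => rw [delannoyPaths_succ_zero]; exact (iha 0).image _
    | succ b ih =>
      rw [delannoyPaths_succ_succ]
      exact ((iha _).image _).union ((ih.image _).union ((iha _).image _))

lemma delannoy_zero_zero : delannoy 0 0 = 1 := by
  change (delannoyPaths 0 0).ncard = 1
  rw [delannoyPaths_zero_zero, Set.ncard_singleton]

lemma delannoy_zero_succ (b : ℕ) : delannoy 0 (b + 1) = delannoy 0 b := by
  change (delannoyPaths 0 (b + 1)).ncard = _
  rw [delannoyPaths_zero_succ, Set.ncard_image_of_injective _ List.cons_injective]
  rfl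

lemma delannoy_succ_zero (a : ℕ) : delannoy (a + 1) 0 = delannoy a 0 := by
  change (delannoyPaths (a + 1) 0).ncard = _
  rw [delannoyPaths_succ_zero, Set.ncard_image_of_injective _ List.cons_injective]
  rfl

lemma delannoy_succ_succ (a b : ℕ) : delannoy (a + 1) (b + 1) =
    delannoy a (b + 1) + (delannoy (a + 1) b + delannoy a b) := by
  have hdisj : ∀ {s t : ℕ × ℕ} (A B : Set (List (ℕ × ℕ))), s ≠ t →
      Disjoint (List.cons s '' A) (List.cons t '' B) := by
    intro s t A B hst
    rw [Set.disjoint_left]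
    rintro _ ⟨P, -, rfl⟩ ⟨Q, -, h⟩
    exact hst (List.cons.inj h).1.symm
  have hfin : ∀ a b, Finite (delannoyPaths a b) := finite_delannoyPaths
  change (delannoyPaths (a + 1) (b + 1)).ncard = _
  rw [delannoyPaths_succ_succ, Set.ncard_union_eq, Set.ncard_union_eq,
    Set.ncard_image_of_injective _ List.cons_injective,
    Set.ncard_image_of_injective _ List.cons_injective,
    Set.ncard_image_of_injective _ List.cons_injective]
  · rfl
  · exact hdisj _ _ (by simp)
  · exact Set.disjoint_union_right.2 ⟨hdisj _ _ (by simp), hdisj _ _ (by simp)⟩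

lemma eval_delannoyPoly (n : ℕ) (x : ℤ) : (delannoyPoly (n + 1)).eval x =
    ∑ k ∈ Finset.range (n + 1), (delannoy (n - k) k : ℤ) * x ^ k := by
  simp [delannoyPoly, Polynomial.eval_finsetSum]

lemma eval_delannoyPoly_one (x : ℤ) : (delannoyPoly 1).eval x = 1 := by
  rw [eval_delannoyPoly]
  simp [delannoy_zero_zero]

lemma eval_delannoyPoly_two (x : ℤ) : (delannoyPoly 2).eval x = 1 + x := by
  rw [eval_delannoyPoly]
  simp [Finset.sum_range_succ, delannoy_succ_zero, delannoy_zero_succ, delannoy_zero_zero]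

/-- This is the Delannoy recurrence summed along an antidiagonal: a step `(1,0)` contributes the
factor `1`, `(0,1)` the factor `x`, and `(1,1)` the factor `x` with a drop of two in the index. -/
lemma eval_delannoyPoly_add_three (n : ℕ) (x : ℤ) : (delannoyPoly (n + 3)).eval x =
    (1 + x) * (delannoyPoly (n + 2)).eval x + x * (delannoyPoly (n + 1)).eval x := by
  have h : ∀ k ∈ Finset.range (n + 1), (delannoy (n + 2 - (k + 1)) (k + 1) : ℤ) * x ^ (k + 1) =
      (delannoy (n + 1 - (k + 1)) (k + 1) : ℤ) * x ^ (k + 1) +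
        x * ((delannoy (n + 1 - k) k : ℤ) * x ^ k) + x * ((delannoy (n - k) k : ℤ) * x ^ k) := by
    intro k hk
    rw [Finset.mem_range] at hk
    rw [show n + 2 - (k + 1) = n - k + 1 by omega, show n + 1 - (k + 1) = n - k by omega,
      show n + 1 - k = n - k + 1 by omega, delannoy_succ_succ]
    push_cast
    ring
  have e1 : (delannoyPoly (n + 3)).eval x = _ := eval_delannoyPoly (n + 2) x
  have e2 : (delannoyPoly (n + 2)).eval x =
      (∑ k ∈ Finset.range (n + 1), (delannoy (n + 1 - (k + 1)) (k + 1) : ℤ) * x ^ (k + 1)) +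
        delannoy (n + 1) 0 := by
    rw [eval_delannoyPoly (n + 1) x, Finset.sum_range_succ', pow_zero, mul_one, Nat.sub_zero]
  have e3 : (delannoyPoly (n + 2)).eval x =
      (∑ k ∈ Finset.range (n + 1), (delannoy (n + 1 - k) k : ℤ) * x ^ k) +
        delannoy 0 (n + 1) * x ^ (n + 1) := by
    rw [eval_delannoyPoly (n + 1) x, Finset.sum_range_succ, Nat.sub_self]
  have e4 := eval_delannoyPoly n x
  rw [add_mul, one_mul]
  -- The two copies of the middle polynomial are expanded differently. The one with factor `1`
  -- splits off `k = 0` and the one with factor `x` splits off the top term; they supply the two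
  -- boundary terms on the left.
  nth_rw 1 [e2]
  rw [e3, e4, e1, Finset.sum_range_succ, Finset.sum_range_succ', Finset.sum_congr rfl h,
    Finset.sum_add_distrib, Finset.sum_add_distrib, ← Finset.mul_sum, ← Finset.mul_sum,
    Nat.sub_self, Nat.sub_zero, delannoy_succ_zero, delannoy_zero_succ]
  ring

lemma eval_delannoyPoly_eq_pell (n : ℕ) : (delannoyPoly n).eval 1 = (pell n : ℤ) := by
  induction n using Nat.strong_induction_on with
  | _ n ih =>
    match n, ih with
    | 0, _ => simp [delannoyPoly, pell]
    | 1, _ => simp [eval_delannoyPoly_one, pell]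
    | 2, _ => simp [eval_delannoyPoly_two, pell]
    | m + 3, ih =>
      rw [eval_delannoyPoly_add_three, ih (m + 2) (by omega), ih (m + 1) (by omega),
        show pell (m + 3) = 2 * pell (m + 2) + pell (m + 1) from rfl]
      push_cast
      ring

/-! ### The number of labeled Pell paths -/

variable {F : Type*} [Field F]

/-- The labeled Pell paths of length `N`. -/
abbrev PathOfLength (F : Type*) [Field F] (N : ℕ) : Type _ :=
  {P : List (LabeledStep F pellSteps) // pathLength P = N}

instance : Unique (PathOfLength F 0) where
  default := ⟨[], rfl⟩
  uniq := by
    rintro ⟨P, hP⟩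
    cases P with
    | nil => rfl
    | cons s P =>
      have := s.size_pos
      rw [pathLength_cons] at hP
      omega

/-- A path of length `1` is a single step. -/
def pathOfLengthOneEquiv (F : Type*) [Field F] : (Unit ⊕ Fˣ) ≃ PathOfLength F 1 :=
  Equiv.ofBijective (Sum.elim (fun _ => ⟨[flatStep F], rfl⟩) fun t => ⟨[upStep t], rfl⟩) <| by
    constructor
    · rintro (_ | t) (_ | t') h
      · rfl
      · exact absurd (List.cons.inj (congrArg Subtype.val h)).1 (flatStep_ne_upStep t')
      · exact absurd (List.cons.inj (congrArg Subtype.val h)).1.symm (flatStep_ne_upStep t)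
      · rw [upStep_injective (List.cons.inj (congrArg Subtype.val h)).1]
    · rintro ⟨P, hP⟩
      cases P with
      | nil => exact absurd hP zero_ne_one
      | cons s P =>
        have hs := s.size_pos
        rw [pathLength_cons] at hP
        have hP0 : P = [] := congrArg Subtype.val
          (Subsingleton.elim (⟨P, by omega⟩ : PathOfLength F 0) ⟨[], rfl⟩)
        subst hP0
        rcases s.cases with rfl | ⟨t, rfl⟩ | ⟨t, rfl⟩
        · exact ⟨Sum.inl (), rfl⟩
        · exact ⟨Sum.inr t, rfl⟩
        · rw [size_diagStep] at hP
          omega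

/-- A path is a first step followed by a shorter path. -/
def pathOfLengthEquiv (F : Type*) [Field F] (N : ℕ) :
    (PathOfLength F (N + 1) ⊕ Fˣ × PathOfLength F (N + 1)) ⊕ Fˣ × PathOfLength F N ≃
      PathOfLength F (N + 2) :=
  Equiv.ofBijective (Sum.elim (Sum.elim
    (fun P => ⟨flatStep F :: P.1, by rw [pathLength_cons, P.2, size_flatStep]; omega⟩)
    fun P => ⟨upStep P.1 :: P.2.1, by rw [pathLength_cons, P.2.2, size_upStep]; omega⟩)
    fun P => ⟨diagStep P.1 :: P.2.1, by rw [pathLength_cons, P.2.2, size_diagStep]; omega⟩) <| by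
    constructor
    · rintro ((P | ⟨t, P⟩) | ⟨t, P⟩) ((P' | ⟨t', P'⟩) | ⟨t', P'⟩) h <;>
        obtain ⟨h1, h2⟩ := List.cons.inj (congrArg Subtype.val h)
      · rw [Subtype.ext h2]
      · exact absurd h1 (flatStep_ne_upStep t')
      · exact absurd (congrArg LabeledStep.size h1) (by simp)
      · exact absurd h1.symm (flatStep_ne_upStep t)
      · dsimp only at h1 h2
        rw [Subtype.ext h2, upStep_injective h1]
      · exact absurd (congrArg LabeledStep.size h1) (by simp)
      · exact absurd (congrArg LabeledStep.size h1) (by simp)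
      · exact absurd (congrArg LabeledStep.size h1) (by simp)
      · dsimp only at h1 h2
        rw [Subtype.ext h2, diagStep_injective h1]
    · rintro ⟨P, hP⟩
      cases P with
      | nil => exact absurd hP (by simp)
      | cons s P =>
        rw [pathLength_cons] at hP
        rcases s.cases with rfl | ⟨t, rfl⟩ | ⟨t, rfl⟩
        · rw [size_flatStep] at hP
          exact ⟨Sum.inl (Sum.inl ⟨P, by omega⟩), rfl⟩
        · rw [size_upStep] at hP
          exact ⟨Sum.inl (Sum.inr (t, ⟨P, by omega⟩)), rfl⟩
        · rw [size_diagStep] at hP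
          exact ⟨Sum.inr (t, ⟨P, by omega⟩), rfl⟩

/-- By the first step, the count satisfies the recurrence of `eval_delannoyPoly_add_three` at `x = q
- 1`, the number of labels. The index shifts by one because paths of length `N` belong to `n = N +
1`. -/
lemma card_pathOfLength [Fintype F] (N : ℕ) : Finite (PathOfLength F N) ∧
    (Nat.card (PathOfLength F N) : ℤ) =
      (delannoyPoly (N + 1)).eval ((Fintype.card F : ℤ) - 1) := by
  have hq : (Nat.card Fˣ : ℤ) = (Fintype.card F : ℤ) - 1 := by
    rw [Nat.card_units, Nat.card_eq_fintype_card, Nat.cast_sub Fintype.card_pos, Nat.cast_one]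
  induction N using Nat.strong_induction_on with
  | _ N ih =>
    match N, ih with
    | 0, _ =>
      refine ⟨inferInstance, ?_⟩
      rw [Nat.card_unique, eval_delannoyPoly_one, Nat.cast_one]
    | 1, _ =>
      refine ⟨Finite.of_equiv _ (pathOfLengthOneEquiv F), ?_⟩
      rw [← Nat.card_congr (pathOfLengthOneEquiv F), Nat.card_sum, Nat.cast_add, hq,
        eval_delannoyPoly_two, Nat.card_unique, Nat.cast_one]
    | M + 2, ih =>
      obtain ⟨hf1, h1⟩ := ih (M + 1) (by omega)
      obtain ⟨hf0, h0⟩ := ih M (by omega)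
      refine ⟨Finite.of_equiv _ (pathOfLengthEquiv F M), ?_⟩
      rw [← Nat.card_congr (pathOfLengthEquiv F M), Nat.card_sum, Nat.card_sum, Nat.card_prod,
        Nat.card_prod, eval_delannoyPoly_add_three]
      push_cast
      rw [hq, h0, h1]
      ring

lemma ncard_heisenbergSupercharacters [Fintype F] {θ : AddChar F ℂ} (hθ : θ ≠ 1) {n : ℕ}
    (hn : 1 ≤ n) : ((heisenbergSupercharacters n θ).ncard : ℤ) =
      (delannoyPoly n).eval ((Fintype.card F : ℤ) - 1) := by
  obtain ⟨N, rfl⟩ : ∃ N, n = N + 1 := ⟨n - 1, by omega⟩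
  rw [← (bijOn_pathPartition hθ hn).ncard_eq, Set.ncard_univ, ← (card_pathOfLength N).2]
  congr 1
  refine Nat.card_congr (Equiv.subtypeEquivRight fun P => ?_)
  rw [pathLength]
  omega

end PellHeisenberg

end

open PellHeisenberg
theorem mainTheorem3 {F : Type*} [Field F] [Fintype F] (θ : AddChar F ℂ) (hθ : θ ≠ 1)
    (n : ℕ) (hn : 1 ≤ n) :
    (∃ Λ : LabeledPath n F pellSteps → LabeledPartition n F,
      (∀ (P : LabeledPath n F pellSteps) (L : LabeledPartition n F),
        IsPathPartition P L ↔ L = Λ P) ∧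
      Set.BijOn (fun P => superchar θ (Λ P).functional) Set.univ
        (heisenbergSupercharacters n θ)) ∧
    ((heisenbergSupercharacters n θ).ncard : ℤ) =
      (delannoyPoly n).eval ((Fintype.card F : ℤ) - 1) ∧
    (delannoyPoly n).eval 1 = (pell n : ℤ) ∧
    (Fintype.card F = 2 → (heisenbergSupercharacters n θ).ncard = pell n) := by
  have hcard := ncard_heisenbergSupercharacters hθ hn
  refine ⟨⟨pathPartition, isPathPartition_iff, bijOn_pathPartition hθ hn⟩, hcard,
    eval_delannoyPoly_eq_pell n, fun h2 => ?_⟩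
  rw [h2, show ((2 : ℕ) : ℤ) - 1 = 1 by norm_num, eval_delannoyPoly_eq_pell] at hcard
  exact_mod_cast hcard
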